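/- Let $\mathbb T=\mathbb R/\mathbb Z$ with Lebesgue measure, and let $W:\mathbb T\to(-\infty,\infty]$ satisfy: - (H1) $W\in L^1(\mathbb T)\cap C^2(\mathbb T\setminus\{0\})$ (in particular $W$ is finite off $0$) and $\int_{\mathbb T}W\,dx=0$; - (H2) $W(-x)=W(x)$; - (H3) $\lim_{x\to0}W(x)=W(0)=\infty$; - (H4) there is $C_1>0$ with $W''(x)\ge C_1$ for all $x\ne0$. For a Borel probability measure $\rho$ on $\mathbb T$ put $V[\rho]=W*\rho$, i.e. $V[\rho](x)=\int W(x-y)\,d\rho(y)\in(-\infty,\infty]$, and $$\mathcal D[\rho]=\sup_I\big(\rho(I)-|I|\big),\qquad \mathcal H[\rho]=-\operatorname{ess\,inf}_{\mathbb T}V[\rho],\qquad \mathcal G_\alpha[\rho]=\mathcal H[\rho]/\mathcal D[\rho]^\alpha,$$ where $I$ runs over the closed intervals $[a,b]$, $a\le b<a+1$, of $\mathbb T$. Let $\alpha\ge0$, $0<d\le1$, and let $\mathcal M_{\mathcal D\ge d}$ be the set of Borel probability measures $\rho$ on $\mathbb T$ with $\mathcal D[\rho]\ge d$. (i) There are a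 measure $\rho$ and a number $M$ such that $(*)$ $\rho$ minimizes $\mathcal G_\alpha$ over $\mathcal M_{\mathcal D\ge d}$, $\rho$ is even, $0\le M<1/2$, and $\mathcal D[\rho]=\rho(I)-|I|$ for $I=[-M,M]$. Moreover, every pair $(\rho,M)$ with $(*)$, with $I=[-M,M]$, has the following properties. (ii) $\rho=m(\delta_M+\delta_{-M})+\rho_1$ for some $0<m\le 1/2$ and some measure $\rho_1$ of total mass $1-2m$ whose support is $J\cup K$, where $J\subsetneq I^c$ and $K\subsetneq I$ are (possibly empty) closed intervals. (iii) $V[\rho](x)\le\operatorname{ess\,inf}V[\rho]$ for every $x\in\operatorname{supp}\rho\setminus\{\pm M\}$. (iv) Assume in addition (H5): there is $C_2>0$ such that for all $0<r<1/2$ and $x\in\mathbb T$, $$\frac1{2r}\int_{x-r}^{x+r}W(y)\,dy-2\inf W\le C_2\,\big(W(x)-2\inf W\big).$$ Then $\rho$ is the only Borel probability measure $\mu$ on $\mathbb T$ such that $\mu(\{M\})=\rho(\{M\})$, $\mu(\{-M\})=\rho(\{-M\})$, and $V[\mu](x)\le\operatorname{ess\,inf}V[\mu]$ for every $x\in\operatorname{supp}\mu\setminus\{\pm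 M\}$. -/

import Mathlib

open MeasureTheory Set Filter Topology

noncomputable section

/-- The torus `ℝ / ℤ`; its `volume` is Lebesgue measure, of total mass one. -/
abbrev Torus : Type := UnitAddCircle

/-- The closed interval `[a, b]` of the torus, for real `a ≤ b < a + 1`. -/
def closedArc (a b : ℝ) : Set Torus := (fun t : ℝ => (t : Torus)) '' Icc a b

/-- A possibly empty closed interval of the torus (one-point intervals included). -/
def IsClosedInterval (S : Set Torus) : Prop :=
  S = ∅ ∨ ∃ a b : ℝ, a ≤ b ∧ b < a + 1 ∧ S = closedArc a b

/-- The integral of an extended real function, as the integral of the positive part minus the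
integral of the negative part. Below it is only used for functions that are bounded from below
and for finite measures, so the second term is finite and the value may be `⊤`. -/
def extIntegral (μ : Measure Torus) (f : Torus → EReal) : EReal :=
  ((∫⁻ x, (f x).toENNReal ∂μ : ENNReal) : EReal) -
    ((∫⁻ x, (-f x).toENNReal ∂μ : ENNReal) : EReal)

/-- The potential `V[ρ] = W * ρ` generated by `ρ`, with values in `(-∞, ∞]`. -/
def potentialField (W : Torus → EReal) (ρ : Measure Torus) (x : Torus) : EReal :=
  extIntegral ρ (fun y => W (x - y))

/-- Assumptions (H1)-(H4) on an interaction potential `W : 𝕋 → (-∞, ∞]`. Derivatives are those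
of the periodic function `t ↦ W t` on the real line, away from the integers. -/
structure IsAdmissiblePotential (W : Torus → EReal) : Prop where
  /-- `W` takes real values away from the origin. -/
  real_valued : ∀ x : Torus, x ≠ 0 → W x ≠ ⊤ ∧ W x ≠ ⊥
  /-- `W` is integrable. -/
  integrable : Integrable (fun x : Torus => (W x).toReal) volume
  /-- `W` is twice continuously differentiable away from the origin. -/
  contDiffOn : ContDiffOn ℝ 2 (fun t : ℝ => (W (t : Torus)).toReal) {t : ℝ | (t : Torus) ≠ 0}
  /-- `W` has mean zero. -/
  mean_zero : ∫ x : Torus, (W x).toReal = 0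
  /-- `W` is even. -/
  even : ∀ x : Torus, W (-x) = W x
  /-- `W` is infinite at the origin. -/
  at_zero : W 0 = ⊤
  /-- `W` tends to infinity at the origin. -/
  tendsto_zero : Tendsto W (𝓝[≠] 0) (𝓝 ⊤)
  /-- `W'' ≥ C₁ > 0` away from the origin. -/
  convex : ∃ C₁ : ℝ, 0 < C₁ ∧ ∀ t : ℝ, (t : Torus) ≠ 0 →
    C₁ ≤ deriv (deriv (fun s : ℝ => (W (s : Torus)).toReal)) t

/-- Assumption (H5): the averages of `W - 2 inf W` over intervals centred at `x` are bounded by a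
constant times the value at `x`. -/
def AverageBound (W : Torus → EReal) : Prop :=
  ∃ C₂ : ℝ, 0 < C₂ ∧ ∀ r : ℝ, 0 < r → r < 1 / 2 → ∀ x : ℝ,
    (((1 / (2 * r)) * ∫ y in (x - r)..(x + r), (W (y : Torus)).toReal : ℝ) : EReal)
        - 2 * (⨅ z : Torus, W z)
      ≤ (C₂ : EReal) * (W (x : Torus) - 2 * (⨅ z : Torus, W z))

/-- The excess `∫_I (ρ - 1) dx = ρ(I) - |I|` over the interval `I = [a, b]`, `a ≤ b < a + 1`. -/
def excess (ρ : Measure Torus) (a b : ℝ) : ℝ := ρ.real (closedArc a b) - (b - a)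

/-- The discrepancy `𝓓[ρ]`, the supremum of the excess over all closed intervals. -/
def discrepancy (ρ : Measure Torus) : ℝ :=
  sSup {s : ℝ | ∃ a b : ℝ, a ≤ b ∧ b < a + 1 ∧ s = excess ρ a b}

/-- The height `𝓗[ρ] = - ess inf (W * ρ)`. -/
def height (W : Torus → EReal) (ρ : Measure Torus) : EReal :=
  -essInf (potentialField W ρ) volume

/-- The functional `𝓖_α[ρ] = 𝓗[ρ] / 𝓓[ρ] ^ α`. -/
def ratioFunctional (W : Torus → EReal) (α : ℝ) (ρ : Measure Torus) : EReal :=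
  height W ρ / ((discrepancy ρ ^ α : ℝ) : EReal)

/-- The probability measures with discrepancy at least `d`. -/
def discrepancyAtLeast (d : ℝ) : Set (Measure Torus) :=
  {ρ | IsProbabilityMeasure ρ ∧ d ≤ discrepancy ρ}

/-- `ρ` minimizes `𝓖_α` among the probability measures with discrepancy at least `d`. -/
def IsRatioMinimizer (W : Torus → EReal) (α d : ℝ) (ρ : Measure Torus) : Prop :=
  ρ ∈ discrepancyAtLeast d ∧
    ∀ μ ∈ discrepancyAtLeast d, ratioFunctional W α ρ ≤ ratioFunctional W α μ

/-- `ρ` is an even minimizer whose discrepancy is attained on the interval `[-M, M]`. -/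
structure IsEvenMinimizer (W : Torus → EReal) (α d : ℝ) (ρ : Measure Torus) (M : ℝ) : Prop where
  isMinimizer : IsRatioMinimizer W α d ρ
  even : ρ.map (fun x => -x) = ρ
  nonneg : 0 ≤ M
  lt_half : M < 1 / 2
  witness : discrepancy ρ = excess ρ (-M) M

/-- `V[ρ] ≤ ess inf V[ρ]` at every point of the support of `ρ` other than `±M`. -/
def IsSedimentAway (W : Torus → EReal) (M : ℝ) (ρ : Measure Torus) : Prop :=
  ∀ x ∈ ρ.support, x ≠ (M : Torus) → x ≠ ((-M : ℝ) : Torus) →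
    potentialField W ρ x ≤ essInf (potentialField W ρ) volume

end

/-! Subtract from `W` its minimum, which is attained at `1/2`. This leaves a kernel `w` with values
in `[0, ∞]`, so potentials and energies become lower integrals, and the height is `∫ w` minus the
essential infimum of `w * ρ`.

Existence is the direct method. Centring an optimal arc at `0` and averaging with the reflection
keeps the discrepancy and does not lower the essential infimum (`exists_even_of_discrepancy_pos`).
Along weakly convergent measures, the excess over convergent arcs (`le_excess_of_tendsto`) and the
essential infimum (`le_essInf_kernelPotential_of_tendsto`) are both upper semicontinuous, the right
direction for minimizing the quotient.

For (iii), suppose the potential exceeds its essential infimum at a support point other than `±M`.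
Move a little of the mass near it by `±δ`, half each way. Convexity raises the potential away from
the point, near the point there was room to spare, and the mass of `I` is unchanged. The height
drops and the discrepancy does not, against minimality (`exists_essInf_kernelPotential_lt`).

For (ii), strict convexity forbids a massless gap between two points where the potential is at most
its essential infimum (`measure_arc_ne_zero`), so the rest of the support has no holes inside `I` or
outside it. If `±M` carried no mass, the measure would be Lebesgue measure
(`eq_volume_of_le_essInf`), whose discrepancy is not positive.

That last step and (iv) rest on strict positive definiteness. Two integrations by parts give `w x =
∫ W''(s) (s - |x|)⁺ ds` over `(0, 1/2)`, and each tent is the autocorrelation of the indicator of a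
ball, so the energy of `ρ` is a positive combination of the squares `ρ(B(z, s/2))²`
(`measure_eq_of_energy_le`). In (iv), integrating each potential against both measures gives the
reverse of the positivity inequality; (H5) is what makes the essential infimum a lower bound
everywhere (`essInf_le_kernelPotential`), as the competing measure may charge null sets. -/

noncomputable section

/-! ### Potentials of nonnegative convex kernels. -/

/-- The properties of the nonnegative kernel `W - inf W` used below. -/
structure IsConvexKernel (w : Torus → ENNReal) : Prop where
  zero : w 0 = ⊤
  ne_top : ∀ x, x ≠ 0 → w x ≠ ⊤
  even : ∀ x, w (-x) = w x
  continuous : Continuous w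
  lintegral_ne_top : ∫⁻ x, w x ≠ ⊤
  convex : ∃ C : ℝ, 0 < C ∧ ∀ a b s t : ℝ, a < b → (∀ n : ℤ, (n : ℝ) ∉ Ioo a b) →
    0 < s → 0 < t → s + t = 1 →
    w ((s * a + t * b : ℝ) : Torus) + ENNReal.ofReal (C * s * t * (b - a) ^ 2) ≤
      ENNReal.ofReal s * w (a : Torus) + ENNReal.ofReal t * w (b : Torus)
  tents : ∃ g : ℝ → ENNReal, Measurable g ∧ (∀ s ∈ Ioo (0 : ℝ) (1 / 2), g s ≠ 0) ∧
    (∀ s, g s ≠ ⊤) ∧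
    ∀ x, w x = ∫⁻ s in Ioo (0 : ℝ) (1 / 2), g s * ENNReal.ofReal (s - ‖x‖)

/-- The potential of a measure for a nonnegative kernel. -/
def kernelPotential (w : Torus → ENNReal) (ρ : Measure Torus) (x : Torus) : ENNReal :=
  ∫⁻ y, w (x - y) ∂ρ

/-- Fatou's lemma. Neighbourhood filters are countably generated, so a violating sequence can be
extracted. -/
theorem lowerSemicontinuous_kernelPotential {w : Torus → ENNReal} (hw : Continuous w)
    (ρ : Measure Torus) : LowerSemicontinuous (kernelPotential w ρ) := by
  intro x c hc
  by_contra hcon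
  rw [not_eventually] at hcon
  obtain ⟨u, hu, huc⟩ := exists_seq_forall_of_frequently hcon
  have h1 : kernelPotential w ρ x ≤ liminf (fun n => kernelPotential w ρ (u n)) atTop := by
    calc kernelPotential w ρ x = ∫⁻ y, liminf (fun n => w (u n - y)) atTop ∂ρ := by
          refine lintegral_congr fun y => ?_
          refine (Tendsto.liminf_eq ?_).symm
          exact (hw.tendsto _).comp (hu.sub_const y)
      _ ≤ _ := lintegral_liminf_le fun n => (hw.comp (by fun_prop)).measurable
  have h2 : liminf (fun n => kernelPotential w ρ (u n)) atTop ≤ c :=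
    (liminf_le_liminf (Eventually.of_forall fun n => not_lt.1 (huc n))).trans_eq
      (liminf_const c)
  exact absurd (h1.trans h2) (not_le.2 hc)

theorem measurable_kernelPotential {w : Torus → ENNReal} (hw : Continuous w)
    (ρ : Measure Torus) : Measurable (kernelPotential w ρ) :=
  (lowerSemicontinuous_kernelPotential hw ρ).measurable

theorem kernelPotential_add (w : Torus → ENNReal) (α β : Measure Torus) (x : Torus) :
    kernelPotential w (α + β) x = kernelPotential w α x + kernelPotential w β x :=
  lintegral_add_measure _ _ _

theorem kernelPotential_smul (w : Torus → ENNReal) (c : ENNReal) (α : Measure Torus) (x : Torus) :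
    kernelPotential w (c • α) x = c * kernelPotential w α x := by
  simp [kernelPotential, lintegral_smul_measure]

theorem lintegral_kernelPotential_comm {w : Torus → ENNReal} (hw : IsConvexKernel w)
    (α β : Measure Torus) [SFinite α] [SFinite β] :
    ∫⁻ x, kernelPotential w α x ∂β = ∫⁻ x, kernelPotential w β x ∂α := by
  unfold kernelPotential
  rw [lintegral_lintegral_swap]
  · refine lintegral_congr fun y => lintegral_congr fun x => ?_
    rw [← hw.even, neg_sub]
  · exact (hw.continuous.comp (by fun_prop : Continuous fun p : Torus × Torus => p.1 - p.2)).measurable.aemeasurable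

theorem kernelPotential_volume (w : Torus → ENNReal) (x : Torus) :
    kernelPotential w volume x = ∫⁻ y, w y :=
  lintegral_sub_left_eq_self w x

/-- Lebesgue measure has constant potential, so symmetry of the mutual energy computes the mean of
every potential. -/
theorem lintegral_kernelPotential_volume {w : Torus → ENNReal} (hw : IsConvexKernel w)
    (ρ : Measure Torus) [IsFiniteMeasure ρ] :
    ∫⁻ x, kernelPotential w ρ x = (∫⁻ x, w x) * ρ univ := by
  rw [lintegral_kernelPotential_comm hw]
  simp [kernelPotential_volume]

theorem kernelPotential_eq_top {w : Torus → ENNReal} (hw : IsConvexKernel w)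
    {ρ : Measure Torus} {x : Torus} (hx : ρ {x} ≠ 0) : kernelPotential w ρ x = ⊤ := by
  have : ∫⁻ y in {x}, w (x - y) ∂ρ ≤ kernelPotential w ρ x := setLIntegral_le_lintegral _ _
  rw [lintegral_singleton] at this
  simpa [hw.zero, ENNReal.top_mul hx] using this

theorem ae_essInf_le_kernelPotential (w : Torus → ENNReal) (ρ : Measure Torus) :
    ∀ᵐ x, essInf (kernelPotential w ρ) volume ≤ kernelPotential w ρ x := ae_essInf_le

theorem essInf_kernelPotential_ne_top {w : Torus → ENNReal} (hw : IsConvexKernel w)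
    (ρ : Measure Torus) [IsFiniteMeasure ρ] : essInf (kernelPotential w ρ) volume ≠ ⊤ := by
  intro h
  have h1 : ∫⁻ x, kernelPotential w ρ x = ⊤ := by
    have : ∫⁻ _ : Torus, (⊤ : ENNReal) ≤ ∫⁻ x, kernelPotential w ρ x := by
      refine lintegral_mono_ae ?_
      filter_upwards [ae_essInf_le_kernelPotential w ρ] with x hx
      rwa [h] at hx
    simpa using this
  rw [lintegral_kernelPotential_volume hw] at h1
  exact ENNReal.mul_ne_top hw.lintegral_ne_top (measure_ne_top _ _) h1

/-- Between two points where the potential is at most its essential infimum there is mass. -/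
theorem measure_arc_ne_zero {w : Torus → ENNReal} (hw : IsConvexKernel w)
    (ρ : Measure Torus) [IsProbabilityMeasure ρ] {a b : ℝ} (hab : a < b)
    (ha : kernelPotential w ρ (a : Torus) ≤ essInf (kernelPotential w ρ) volume)
    (hb : kernelPotential w ρ (b : Torus) ≤ essInf (kernelPotential w ρ) volume) :
    ρ ((fun t : ℝ => (t : Torus)) '' Ioo a b) ≠ 0 := by
  intro h0
  obtain ⟨C, hC, hconv⟩ := hw.convex
  set u := essInf (kernelPotential w ρ) volume with hu
  have hut : u ≠ ⊤ := essInf_kernelPotential_ne_top hw ρ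
  -- For almost every `z` the pole of `w (· - z)` lies off the open arc, so strong convexity on the
  -- arc survives integration against `ρ`.
  have key : ∀ s t : ℝ, 0 < s → 0 < t → s + t = 1 →
      kernelPotential w ρ ((s * a + t * b : ℝ) : Torus) < u := by
    intro s t hs ht hst
    have hm : ∀ x : Torus, Measurable fun z => w (x - z) := fun x =>
      (hw.continuous.comp (by fun_prop)).measurable
    have h1 : kernelPotential w ρ ((s * a + t * b : ℝ) : Torus) +
        ENNReal.ofReal (C * s * t * (b - a) ^ 2) ≤
        ENNReal.ofReal s * kernelPotential w ρ (a : Torus) +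
        ENNReal.ofReal t * kernelPotential w ρ (b : Torus) := by
      unfold kernelPotential
      rw [← lintegral_const_mul _ (hm _), ← lintegral_const_mul _ (hm _),
        ← lintegral_add_left ((hm _).const_mul _)]
      have : ENNReal.ofReal (C * s * t * (b - a) ^ 2) =
          ∫⁻ _, ENNReal.ofReal (C * s * t * (b - a) ^ 2) ∂ρ := by simp
      rw [this, ← lintegral_add_left (hm _)]
      refine lintegral_mono_ae ?_
      have h0' := compl_mem_ae_iff.2 h0
      filter_upwards [h0'] with z hz
      obtain ⟨ζ, rfl⟩ := QuotientAddGroup.mk_surjective z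
      have := hconv (a - ζ) (b - ζ) s t (by linarith) (fun n hn => hz ⟨n + ζ, ⟨by linarith [hn.1],
        by linarith [hn.2]⟩, ?_⟩) hs ht hst
      · have e : s * (a - ζ) + t * (b - ζ) = s * a + t * b - ζ := by
          linear_combination -ζ * hst
        rw [e] at this
        simpa [sub_sub_sub_cancel_right] using this
      · simp only [AddCircle.coe_add]
        have : ((n : ℝ) : Torus) = 0 := by
          rw [AddCircle.coe_eq_zero_iff]; exact ⟨n, by simp⟩
        rw [this, zero_add]
    have h2 : ENNReal.ofReal s * kernelPotential w ρ (a : Torus) +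
        ENNReal.ofReal t * kernelPotential w ρ (b : Torus) ≤ u := by
      calc _ ≤ ENNReal.ofReal s * u + ENNReal.ofReal t * u := by gcongr
        _ = u := by rw [← add_mul, ← ENNReal.ofReal_add hs.le ht.le, hst]; simp
    have h3 : 0 < ENNReal.ofReal (C * s * t * (b - a) ^ 2) := by
      rw [ENNReal.ofReal_pos]; have := sub_pos.2 hab; positivity
    have h4 : kernelPotential w ρ ((s * a + t * b : ℝ) : Torus) ≠ ⊤ := by
      intro h; rw [h, top_add, top_le_iff] at h1; exact hut (top_le_iff.1 (h1 ▸ h2))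
    exact (ENNReal.lt_add_right h4 h3.ne').trans_le (h1.trans h2)
  -- A nonempty open arc has positive Lebesgue measure, so the potential cannot stay below its
  -- essential infimum there.
  have hopen : IsOpen ((fun t : ℝ => (t : Torus)) '' Ioo a b) :=
    QuotientAddGroup.isOpenMap_coe _ isOpen_Ioo
  have hpos : volume ((fun t : ℝ => (t : Torus)) '' Ioo a b) ≠ 0 :=
    (hopen.measure_pos _ ((nonempty_Ioo.2 hab).image _)).ne'
  refine hpos (measure_mono_null ?_ (ae_iff.1 (ae_essInf_le_kernelPotential w ρ)))
  rintro _ ⟨p, hp, rfl⟩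
  have hba : 0 < b - a := sub_pos.2 hab
  have := key ((b - p) / (b - a)) ((p - a) / (b - a)) (div_pos (sub_pos.2 hp.2) hba)
    (div_pos (sub_pos.2 hp.1) hba) (by field_simp; ring)
  have e : (b - p) / (b - a) * a + (p - a) / (b - a) * b = p := by field_simp; ring
  rw [e] at this
  exact not_le.2 this

/-! ### Strict positive definiteness of the energy. -/

theorem exists_coe_eq_abs_le (x : Torus) : ∃ t : ℝ, (t : Torus) = x ∧ -(1 / 2) < t ∧ t ≤ 1 / 2 := by
  have := (AddCircle.coe_image_Ioc_eq (1 : ℝ) (-(1 / 2)))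
  obtain ⟨t, ht, rfl⟩ := this.symm ▸ mem_univ x
  exact ⟨t, rfl, ht.1, by linarith [ht.2]⟩

theorem torus_norm_coe_eq_abs {t : ℝ} (ht : |t| ≤ 1 / 2) : ‖(t : Torus)‖ = |t| :=
  (AddCircle.norm_coe_eq_abs_iff 1 one_ne_zero).2 (by simpa using ht)

theorem torus_coe_add_one (t : ℝ) : ((t + 1 : ℝ) : Torus) = t := by
  rw [AddCircle.coe_add, AddCircle.coe_period, add_zero]

theorem torus_coe_sub_one (t : ℝ) : ((t - 1 : ℝ) : Torus) = t := by
  rw [AddCircle.coe_sub, AddCircle.coe_period, sub_zero]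

theorem volume_torus_closedBall (x : Torus) {r : ℝ} (hr : r ≤ 1 / 2) :
    volume (Metric.closedBall x r) = ENNReal.ofReal (2 * r) := by
  rw [AddCircle.volume_closedBall, min_eq_right (by linarith)]

/-- The tent function is the autocorrelation of the indicator function of a ball. -/
theorem volume_closedBall_zero_inter (x : Torus) {s : ℝ} (hs : s ∈ Ioo (0 : ℝ) (1 / 2)) :
    volume (Metric.closedBall (0 : Torus) (s / 2) ∩ Metric.closedBall x (s / 2)) =
      ENNReal.ofReal (s - ‖x‖) := by
  obtain ⟨hs0, hs1⟩ := hs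
  obtain ⟨t, rfl, ht1, ht2⟩ := exists_coe_eq_abs_le x
  have htabs : |t| ≤ 1 / 2 := abs_le.2 ⟨ht1.le, ht2⟩
  rw [AddCircle.add_projection_respects_measure 1 (-(1 / 2))
    (measurableSet_closedBall.inter measurableSet_closedBall), torus_norm_coe_eq_abs htabs]
  have key : ((QuotientAddGroup.mk ⁻¹' (Metric.closedBall (0 : Torus) (s / 2) ∩
      Metric.closedBall (t : Torus) (s / 2)) : Set ℝ) ∩ Ioc (-(1 / 2)) (-(1 / 2) + 1)) =
      Icc (-(s / 2)) (s / 2) ∩ Icc (t - s / 2) (t + s / 2) := by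
    ext u
    have h1 : |u| ≤ 1 / 2 → (‖(u : Torus)‖ ≤ s / 2 ↔ |u| ≤ s / 2) := fun h => by
      rw [torus_norm_coe_eq_abs h]
    -- The balls could also meet on the far side of the circle. A difference above `1/2` is at most
    -- `1/2 + s/2`, so wrapping leaves at least `1/2 - s/2`, which exceeds `s/2` because `s < 1/2`.
    have h2 : |u| ≤ s / 2 → (‖((u - t : ℝ) : Torus)‖ ≤ s / 2 ↔ |u - t| ≤ s / 2) := by
      intro h
      rw [abs_le] at h htabs
      by_cases hc : |u - t| ≤ 1 / 2
      · rw [torus_norm_coe_eq_abs hc]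
      · refine iff_of_false ?_ (by intro h'; linarith)
        rcases lt_or_ge (u - t) 0 with hneg | hpos
        · rw [abs_of_neg hneg] at hc
          rw [← torus_coe_add_one, torus_norm_coe_eq_abs (abs_le.2 ⟨by linarith, by linarith⟩),
            abs_of_nonneg (by linarith)]
          linarith
        · rw [abs_of_nonneg hpos] at hc
          rw [← torus_coe_sub_one, torus_norm_coe_eq_abs (abs_le.2 ⟨by linarith, by linarith⟩),
            abs_of_nonpos (by linarith)]
          linarith
    simp only [mem_inter_iff, mem_preimage, Metric.mem_closedBall, dist_eq_norm,
      mem_Ioc, mem_Icc]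
    rw [sub_zero, ← AddCircle.coe_sub]
    constructor
    · rintro ⟨⟨ha, hb⟩, hc, hd⟩
      have ha' := (h1 (abs_le.2 ⟨hc.le, by linarith⟩)).1 ha
      have hb' := (h2 ha').1 hb
      rw [abs_le] at ha' hb'
      exact ⟨ha', by linarith, by linarith⟩
    · rintro ⟨ha, hb⟩
      have ha' := abs_le.2 ha
      exact ⟨⟨(h1 (by linarith)).2 ha', (h2 ha').2 (abs_le.2 ⟨by linarith, by linarith⟩)⟩,
        by linarith, by linarith⟩
  rw [key, Icc_inter_Icc, Real.volume_Icc]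
  congr 1
  simp only [max_def, min_def, abs_eq_max_neg]
  split_ifs <;> linarith

theorem volume_closedBall_inter (x y : Torus) {s : ℝ} (hs : s ∈ Ioo (0 : ℝ) (1 / 2)) :
    volume (Metric.closedBall x (s / 2) ∩ Metric.closedBall y (s / 2)) =
      ENNReal.ofReal (s - ‖x - y‖) := by
  rw [norm_sub_rev, ← volume_closedBall_zero_inter (y - x) hs,
    ← measure_preimage_add volume x (Metric.closedBall x (s / 2) ∩ Metric.closedBall y (s / 2))]
  congr 1
  ext z
  simp [dist_eq_norm, sub_sub_eq_add_sub, add_comm]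

theorem measurableSet_dist_le : MeasurableSet {p : (ℝ × Torus) × Torus | dist p.2 p.1.2 ≤ p.1.1 / 2} :=
  (isClosed_le (by fun_prop) (by fun_prop)).measurableSet

theorem measurable_measure_closedBall (α : Measure Torus) [SFinite α] :
    Measurable fun p : ℝ × Torus => α (Metric.closedBall p.2 (p.1 / 2)) :=
  measurable_measure_prodMk_left measurableSet_dist_le

/-- Tonelli, twice. For `α = β` the right side is the integral of a square, which is the source of
positive definiteness. -/
theorem lintegral_lintegral_lintegral_mul {X Y : Type*} [MeasurableSpace X] [MeasurableSpace Y]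
    (μ : Measure X) (α β : Measure Y) [SFinite μ] [SFinite α] [SFinite β] {k : X × Y → ENNReal}
    (hk : Measurable k) :
    ∫⁻ x, ∫⁻ y, (∫⁻ z, k (z, x) * k (z, y) ∂μ) ∂α ∂β =
      ∫⁻ z, (∫⁻ y, k (z, y) ∂α) * (∫⁻ x, k (z, x) ∂β) ∂μ := by
  have hkz : ∀ z, Measurable fun y => k (z, y) := fun z => hk.comp measurable_prodMk_left
  have hα : Measurable fun z => ∫⁻ y, k (z, y) ∂α := Measurable.lintegral_prod_right' hk
  have e1 : ∀ x, ∫⁻ y, (∫⁻ z, k (z, x) * k (z, y) ∂μ) ∂α =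
      ∫⁻ z, k (z, x) * (∫⁻ y, k (z, y) ∂α) ∂μ := by
    intro x
    rw [lintegral_lintegral_swap]
    · exact lintegral_congr fun z => lintegral_const_mul _ (hkz z)
    · exact ((hk.comp (measurable_snd.prodMk measurable_const)).mul
        (hk.comp (measurable_snd.prodMk measurable_fst))).aemeasurable
  simp_rw [e1]
  rw [lintegral_lintegral_swap]
  · refine lintegral_congr fun z => ?_
    rw [lintegral_mul_const _ (hkz z), mul_comm]
  · exact ((hk.comp (measurable_snd.prodMk measurable_fst)).mul
      (hα.comp measurable_snd)).aemeasurable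

theorem measurable_indicator_dist_le {f : Torus → ENNReal} (hf : Measurable f) (r : ℝ) :
    Measurable ({p : Torus × Torus | dist p.1 p.2 ≤ r}.indicator fun p => f p.1) :=
  (hf.comp measurable_fst).indicator
    (isClosed_le (by fun_prop) (by fun_prop) : IsClosed {p : Torus × Torus | dist p.1 p.2 ≤ r}).measurableSet

theorem lintegral_lintegral_volume_closedBall_inter (α β : Measure Torus) [SFinite α] [SFinite β]
    (r : ℝ) :
    ∫⁻ x, ∫⁻ y, volume (Metric.closedBall x r ∩ Metric.closedBall y r) ∂α ∂β =
      ∫⁻ z, α (Metric.closedBall z r) * β (Metric.closedBall z r) := by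
  have hkm := measurable_indicator_dist_le (measurable_const (a := (1 : ENNReal))) r
  have hball : ∀ (γ : Measure Torus) z, γ (Metric.closedBall z r) =
      ∫⁻ x, {p : Torus × Torus | dist p.1 p.2 ≤ r}.indicator (fun _ => 1) (z, x) ∂γ := by
    intro γ z
    rw [← lintegral_indicator_one measurableSet_closedBall]
    refine lintegral_congr fun x => ?_
    simp only [indicator, Metric.mem_closedBall, mem_ofPred_eq, dist_comm x z, Pi.one_apply]
  have hinter : ∀ x y, volume (Metric.closedBall x r ∩ Metric.closedBall y r) =
      ∫⁻ z, {p : Torus × Torus | dist p.1 p.2 ≤ r}.indicator (fun _ => 1) (z, x) *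
        {p : Torus × Torus | dist p.1 p.2 ≤ r}.indicator (fun _ => 1) (z, y) := by
    intro x y
    rw [← lintegral_indicator_one (measurableSet_closedBall.inter measurableSet_closedBall)]
    refine lintegral_congr fun z => ?_
    rw [inter_indicator_one]
    rfl
  simp_rw [hinter, hball]
  exact lintegral_lintegral_lintegral_mul _ _ _ hkm

theorem continuous_tent : Continuous fun p : (ℝ × Torus) × Torus =>
    ENNReal.ofReal (p.1.1 - ‖p.1.2 - p.2‖) :=
  ENNReal.continuous_ofReal.comp (by fun_prop)

/-- The mutual energy of two measures, as a positive combination of products of masses of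
balls. -/
theorem lintegral_kernelPotential_eq {w : Torus → ENNReal} {g : ℝ → ENNReal} (hg : Measurable g)
    (hw : ∀ x, w x = ∫⁻ s in Ioo (0 : ℝ) (1 / 2), g s * ENNReal.ofReal (s - ‖x‖))
    (α β : Measure Torus) [SFinite α] [SFinite β] :
    ∫⁻ x, kernelPotential w α x ∂β = ∫⁻ s in Ioo (0 : ℝ) (1 / 2), g s *
      ∫⁻ z, α (Metric.closedBall z (s / 2)) * β (Metric.closedBall z (s / 2)) := by
  have hT := continuous_tent.measurable
  unfold kernelPotential
  simp_rw [hw]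
  have e1 : ∀ x : Torus,
      ∫⁻ y, (∫⁻ s in Ioo (0 : ℝ) (1 / 2), g s * ENNReal.ofReal (s - ‖x - y‖)) ∂α =
      ∫⁻ s in Ioo (0 : ℝ) (1 / 2), g s * ∫⁻ y, ENNReal.ofReal (s - ‖x - y‖) ∂α := by
    intro x
    rw [lintegral_lintegral_swap]
    · refine lintegral_congr fun s => ?_
      exact lintegral_const_mul _ (hT.comp (measurable_prodMk_left (x := (s, x))))
    · exact ((hg.comp measurable_snd).mul (hT.comp
        ((measurable_snd.prodMk measurable_const).prodMk measurable_fst))).aemeasurable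
  simp_rw [e1]
  have hG : Measurable fun p : ℝ × Torus => ∫⁻ y, ENNReal.ofReal (p.1 - ‖p.2 - y‖) ∂α :=
    hT.lintegral_prod_right
  rw [lintegral_lintegral_swap]
  · refine setLIntegral_congr_fun measurableSet_Ioo fun s hs => ?_
    refine (lintegral_const_mul _ (hG.comp (measurable_prodMk_left (x := s)))).trans ?_
    rw [← lintegral_lintegral_volume_closedBall_inter α β (s / 2)]
    refine congrArg _ (lintegral_congr fun x => lintegral_congr fun y => ?_)
    exact (volume_closedBall_inter x y hs).symm
  · exact ((hg.comp measurable_snd).mul (hG.comp measurable_swap)).aemeasurable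

/-- Comparison with constants on small balls, which allows `f x = ⊤`; this is needed at the pole of
the kernel. -/
theorem tendsto_laverage_closedBall {f : Torus → ENNReal} {x : Torus} (hf : ContinuousAt f x) :
    Tendsto (fun r : ℝ => (ENNReal.ofReal (2 * r))⁻¹ * ∫⁻ z in Metric.closedBall x r, f z)
      (𝓝[>] 0) (𝓝 (f x)) := by
  have hsmall : ∀ {p : Torus → Prop}, (∀ᶠ z in 𝓝 x, p z) →
      ∀ᶠ r : ℝ in 𝓝[>] 0, 0 < r ∧ r ≤ 1 / 2 ∧ ∀ z ∈ Metric.closedBall x r, p z := by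
    intro p hp
    obtain ⟨ε, hε, hεp⟩ := Metric.eventually_nhds_iff_ball.1 hp
    filter_upwards [Ioo_mem_nhdsGT (lt_min hε (by norm_num : (0 : ℝ) < 1 / 2))] with r hr
    exact ⟨hr.1, (hr.2.trans_le (min_le_right _ _)).le, fun z hz => hεp z
      (Metric.closedBall_subset_ball (hr.2.trans_le (min_le_left _ _)) hz)⟩
  have hval : ∀ {r : ℝ}, 0 < r → r ≤ 1 / 2 → ∀ c : ENNReal,
      (ENNReal.ofReal (2 * r))⁻¹ * ∫⁻ _ in Metric.closedBall x r, c = c := by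
    intro r h0 h1 c
    rw [setLIntegral_const, volume_torus_closedBall x h1, mul_comm c, ← mul_assoc,
      ENNReal.inv_mul_cancel (by simpa using h0) ENNReal.ofReal_ne_top, one_mul]
  rw [tendsto_order]
  constructor
  · intro c hc
    obtain ⟨c', hc1, hc2⟩ := exists_between hc
    filter_upwards [hsmall (hf.eventually (lt_mem_nhds hc2))] with r ⟨h0, h1, h⟩
    refine hc1.trans_le ?_
    rw [← hval h0 h1 c']
    refine mul_le_mul_right ?_ _
    exact setLIntegral_mono' measurableSet_closedBall fun z hz => (h z hz).le
  · intro c hc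
    obtain ⟨c', hc1, hc2⟩ := exists_between hc
    filter_upwards [hsmall (hf.eventually (gt_mem_nhds hc1))] with r ⟨h0, h1, h⟩
    refine lt_of_le_of_lt ?_ hc2
    rw [← hval h0 h1 c']
    refine mul_le_mul_right ?_ _
    exact setLIntegral_mono' measurableSet_closedBall fun z hz => (h z hz).le

theorem setLIntegral_closedBall_eq (f : Torus → ENNReal) (x : Torus) (r : ℝ) :
    ∫⁻ z in Metric.closedBall x r, f z =
      ∫⁻ z, {p : Torus × Torus | dist p.1 p.2 ≤ r}.indicator (fun p => f p.1) (z, x) := by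
  rw [← lintegral_indicator measurableSet_closedBall]
  rfl

theorem measurable_setLIntegral_closedBall {f : Torus → ENNReal}
    (hf : Measurable f) (r : ℝ) :
    Measurable fun x => ∫⁻ z in Metric.closedBall x r, f z := by
  simp_rw [setLIntegral_closedBall_eq]
  exact Measurable.lintegral_prod_left' (measurable_indicator_dist_le hf r)

theorem lintegral_setLIntegral_closedBall (α : Measure Torus) [SFinite α] {f : Torus → ENNReal}
    (hf : Measurable f) (r : ℝ) :
    ∫⁻ x, (∫⁻ z in Metric.closedBall x r, f z) ∂α = ∫⁻ z, f z * α (Metric.closedBall z r) := by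
  simp_rw [setLIntegral_closedBall_eq]
  rw [lintegral_lintegral_swap (f := fun x z =>
    {p : Torus × Torus | dist p.1 p.2 ≤ r}.indicator (fun p => f p.1) (z, x))
    ((measurable_indicator_dist_le hf r).comp measurable_swap).aemeasurable]
  refine lintegral_congr fun z => ?_
  rw [← setLIntegral_const, ← lintegral_indicator measurableSet_closedBall]
  refine lintegral_congr fun x => ?_
  simp only [indicator, mem_ofPred_eq, Metric.mem_closedBall, dist_comm x z]

/-- Two finite measures are equal if the masses of almost all balls of almost all small radii
are. -/
theorem measure_eq_of_ae_closedBall {α β : Measure Torus} [IsFiniteMeasure α] [IsFiniteMeasure β]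
    (h : ∀ᵐ s ∂(volume.restrict (Ioo (0 : ℝ) (1 / 2))), ∀ᵐ z : Torus,
      α (Metric.closedBall z (s / 2)) = β (Metric.closedBall z (s / 2))) : α = β := by
  -- Almost every radius is good, hence good radii accumulate at `0`.
  have hfreq : ∃ᶠ r : ℝ in 𝓝[>] 0, r ≤ 1 / 2 ∧ 0 < r ∧ ∀ᵐ z : Torus,
      α (Metric.closedBall z r) = β (Metric.closedBall z r) := by
    rw [(nhdsGT_basis (0 : ℝ)).frequently_iff]
    intro ε hε
    have hpos : volume.restrict (Ioo (0 : ℝ) (1 / 2)) (Ioo 0 (min ε (1 / 2))) ≠ 0 := by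
      rw [Measure.restrict_apply measurableSet_Ioo, inter_eq_left.2
        (Ioo_subset_Ioo_right (min_le_right _ _))]
      simp [hε]
    obtain ⟨s, hs, hs'⟩ := ((frequently_ae_mem_iff.2 hpos).and_eventually h).exists
    have h1 := hs.2.trans_le (min_le_left _ _)
    have h2 := hs.2.trans_le (min_le_right _ _)
    exact ⟨s / 2, ⟨by linarith [hs.1], by linarith [hs.1]⟩, by linarith, by linarith [hs.1], hs'⟩
  obtain ⟨r, hr, hrp⟩ := exists_seq_forall_of_frequently hfreq
  refine ext_of_forall_lintegral_eq_of_IsFiniteMeasure fun φ => ?_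
  have hφ : Measurable fun z => (φ z : ENNReal) := by fun_prop
  obtain ⟨M, hM⟩ : ∃ M : NNReal, ∀ z, φ z ≤ M := ⟨_, fun z => φ.apply_le_nndist_zero z⟩
  have hlim : ∀ γ : Measure Torus, IsFiniteMeasure γ →
      Tendsto (fun n => ∫⁻ x, (ENNReal.ofReal (2 * r n))⁻¹ *
        (∫⁻ z in Metric.closedBall x (r n), (φ z : ENNReal)) ∂γ) atTop
        (𝓝 (∫⁻ x, (φ x : ENNReal) ∂γ)) := by
    intro γ hγ
    refine tendsto_lintegral_of_dominated_convergence (fun _ => M)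
      (fun n => (measurable_setLIntegral_closedBall hφ _).const_mul _) (fun n => ?_)
      (by simp [ENNReal.mul_eq_top]) ?_
    · refine Eventually.of_forall fun x => ?_
      calc (ENNReal.ofReal (2 * r n))⁻¹ * ∫⁻ z in Metric.closedBall x (r n), (φ z : ENNReal)
          ≤ (ENNReal.ofReal (2 * r n))⁻¹ * ∫⁻ z in Metric.closedBall x (r n), (M : ENNReal) := by
            gcongr with z
            exact_mod_cast hM z
        _ = M := by
            rw [setLIntegral_const, volume_torus_closedBall x (hrp n).1, mul_comm (M : ENNReal),
              ← mul_assoc, ENNReal.inv_mul_cancel (by simpa using (hrp n).2.1)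
              ENNReal.ofReal_ne_top, one_mul]
    · refine Eventually.of_forall fun x => ?_
      exact (tendsto_laverage_closedBall (f := fun z => (φ z : ENNReal))
        (by fun_prop)).comp hr
  -- By Tonelli, the integral of the ball averages of `φ` involves the measure only through its
  -- masses of balls.
  refine tendsto_nhds_unique (hlim α inferInstance) ?_
  convert! hlim β inferInstance using 2 with n
  rw [lintegral_const_mul _ (measurable_setLIntegral_closedBall hφ _),
    lintegral_const_mul _ (measurable_setLIntegral_closedBall hφ _),
    lintegral_setLIntegral_closedBall α hφ, lintegral_setLIntegral_closedBall β hφ]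
  congr 1
  refine lintegral_congr_ae ?_
  filter_upwards [(hrp n).2.2] with z hz
  rw [hz]

theorem two_mul_mul_le_sq_add_sq {a b : ENNReal} (ha : a ≠ ⊤) (hb : b ≠ ⊤) :
    2 * (a * b) ≤ a * a + b * b := by
  lift a to NNReal using ha
  lift b to NNReal using hb
  norm_cast
  rw [← NNReal.coe_le_coe]; push_cast
  nlinarith [sq_nonneg ((a : ℝ) - b)]

theorem eq_of_two_mul_mul_eq_sq_add_sq {a b : ENNReal} (ha : a ≠ ⊤) (hb : b ≠ ⊤)
    (h : 2 * (a * b) = a * a + b * b) : a = b := by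
  lift a to NNReal using ha
  lift b to NNReal using hb
  norm_cast at h ⊢
  have h' : (2 : ℝ) * (a * b) = a * a + b * b := by exact_mod_cast h
  have : (a : ℝ) - b = 0 := by
    rw [← sq_eq_zero_iff]; linarith
  exact NNReal.coe_injective (by linarith)

/-- The equality case of `2ab ≤ a² + b²`, integrated without any subtraction. Finiteness of the
integrals turns equality of integrals into equality almost everywhere, first in `s` and then in `z`.
-/
theorem ae_ae_eq_of_lintegral_sq_le {X Y : Type*} [MeasurableSpace X] [MeasurableSpace Y]
    (μ : Measure X) (ν : Measure Y) [IsFiniteMeasure ν] {g : X → ENNReal} (hg : Measurable g)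
    (hg0 : ∀ᵐ s ∂μ, g s ≠ 0) (hgt : ∀ s, g s ≠ ⊤) {a b : X → Y → ENNReal}
    (ha : Measurable (Function.uncurry a)) (hb : Measurable (Function.uncurry b)) {K : ENNReal}
    (hK : K ≠ ⊤) (haK : ∀ s z, a s z ≤ K) (hbK : ∀ s z, b s z ≤ K)
    (hat : ∫⁻ s, g s * ∫⁻ z, a s z * a s z ∂ν ∂μ ≠ ⊤)
    (hbt : ∫⁻ s, g s * ∫⁻ z, b s z * b s z ∂ν ∂μ ≠ ⊤)
    (h : ∫⁻ s, g s * ∫⁻ z, a s z * a s z ∂ν ∂μ + ∫⁻ s, g s * ∫⁻ z, b s z * b s z ∂ν ∂μ ≤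
      2 * ∫⁻ s, g s * ∫⁻ z, a s z * b s z ∂ν ∂μ) :
    ∀ᵐ s ∂μ, ∀ᵐ z ∂ν, a s z = b s z := by
  have hat' : ∀ s z, a s z ≠ ⊤ := fun s z => ne_top_of_le_ne_top hK (haK s z)
  have hbt' : ∀ s z, b s z ≠ ⊤ := fun s z => ne_top_of_le_ne_top hK (hbK s z)
  have has : ∀ s, Measurable (a s) := fun s => ha.comp measurable_prodMk_left
  have hbs : ∀ s, Measurable (b s) := fun s => hb.comp measurable_prodMk_left
  have hP : ∀ s, g s * ∫⁻ z, (a s z * a s z + b s z * b s z) ∂ν =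
      g s * (∫⁻ z, a s z * a s z ∂ν) + g s * ∫⁻ z, b s z * b s z ∂ν := fun s => by
    rw [← mul_add]
    exact congrArg _ (lintegral_add_left ((has s).mul (has s)) _)
  have hQ : ∀ s, g s * ∫⁻ z, 2 * (a s z * b s z) ∂ν = 2 * (g s * ∫⁻ z, a s z * b s z ∂ν) :=
    fun s => by
      rw [mul_left_comm]
      exact congrArg _ (lintegral_const_mul _ ((has s).mul (hbs s)))
  have hle : ∀ s z, 2 * (a s z * b s z) ≤ a s z * a s z + b s z * b s z := fun s z =>
    two_mul_mul_le_sq_add_sq (hat' s z) (hbt' s z)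
  have hm1 : Measurable fun s => g s * ∫⁻ z, a s z * a s z ∂ν :=
    hg.mul (ha.mul ha).lintegral_prod_right
  have hm2 : Measurable fun s => g s * ∫⁻ z, b s z * b s z ∂ν :=
    hg.mul (hb.mul hb).lintegral_prod_right
  have hm3 : Measurable fun s => g s * ∫⁻ z, a s z * b s z ∂ν :=
    hg.mul (ha.mul hb).lintegral_prod_right
  have hQP : ∀ s, g s * ∫⁻ z, 2 * (a s z * b s z) ∂ν ≤
      g s * ∫⁻ z, (a s z * a s z + b s z * b s z) ∂ν := fun s =>
    mul_le_mul_right (lintegral_mono (hle s)) _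
  have hPi : ∫⁻ s, g s * ∫⁻ z, (a s z * a s z + b s z * b s z) ∂ν ∂μ =
      ∫⁻ s, g s * ∫⁻ z, a s z * a s z ∂ν ∂μ + ∫⁻ s, g s * ∫⁻ z, b s z * b s z ∂ν ∂μ := by
    simp_rw [hP]; rw [lintegral_add_left hm1]
  have hQi : ∫⁻ s, g s * ∫⁻ z, 2 * (a s z * b s z) ∂ν ∂μ =
      2 * ∫⁻ s, g s * ∫⁻ z, a s z * b s z ∂ν ∂μ := by
    simp_rw [hQ]; rw [lintegral_const_mul _ hm3]
  have hPm : Measurable fun s => g s * ∫⁻ z, (a s z * a s z + b s z * b s z) ∂ν := by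
    simp_rw [hP]; exact hm1.add hm2
  rw [← hPi, ← hQi] at h
  have hPt := hPi.trans_ne (ENNReal.add_ne_top.2 ⟨hat, hbt⟩)
  have hae := ae_eq_of_ae_le_of_lintegral_le (Eventually.of_forall hQP)
    (ne_top_of_le_ne_top hPt (lintegral_mono hQP)) hPm.aemeasurable h
  filter_upwards [hae, hg0] with s hs hs'
  rw [ENNReal.mul_right_inj hs' (hgt s)] at hs
  have hfin : ∫⁻ z, 2 * (a s z * b s z) ∂ν ≠ ⊤ := by
    refine ne_top_of_le_ne_top (b := ∫⁻ _, 2 * (K * K) ∂ν) ?_ (lintegral_mono fun z =>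
      mul_le_mul_right (mul_le_mul' (haK s z) (hbK s z)) _)
    rw [lintegral_const]
    exact ENNReal.mul_ne_top (ENNReal.mul_ne_top (by simp) (ENNReal.mul_ne_top hK hK))
      (measure_ne_top _ _)
  filter_upwards [ae_eq_of_ae_le_of_lintegral_le (Eventually.of_forall (hle s)) hfin
    (((has s).mul (has s)).add ((hbs s).mul (hbs s))).aemeasurable hs.ge] with z hz
  exact eq_of_two_mul_mul_eq_sq_add_sq (hat' s z) (hbt' s z) hz

/-- Strict positive definiteness of the kernel. -/
theorem measure_eq_of_energy_le {w : Torus → ENNReal} (hw : IsConvexKernel w)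
    {α β : Measure Torus} [IsFiniteMeasure α] [IsFiniteMeasure β]
    (hα : ∫⁻ x, kernelPotential w α x ∂α ≠ ⊤) (hβ : ∫⁻ x, kernelPotential w β x ∂β ≠ ⊤)
    (h : ∫⁻ x, kernelPotential w α x ∂α + ∫⁻ x, kernelPotential w β x ∂β ≤
      2 * ∫⁻ x, kernelPotential w α x ∂β) : α = β := by
  obtain ⟨g, hg, hg0, hgt, hgw⟩ := hw.tents
  -- All energies are now weighted integrals of products of masses of balls, and `h` reverses `2ab ≤
  -- a² + b²`.
  rw [lintegral_kernelPotential_eq hg hgw] at hα hβ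
  simp only [lintegral_kernelPotential_eq hg hgw] at h
  refine measure_eq_of_ae_closedBall ?_
  refine ae_ae_eq_of_lintegral_sq_le _ _ hg ?_ hgt (measurable_measure_closedBall α)
    (measurable_measure_closedBall β) (K := α univ + β univ)
    (ENNReal.add_ne_top.2 ⟨measure_ne_top _ _, measure_ne_top _ _⟩)
    (fun s z => (measure_mono (subset_univ _)).trans le_self_add)
    (fun s z => (measure_mono (subset_univ _)).trans le_add_self) hα hβ h
  filter_upwards [self_mem_ae_restrict measurableSet_Ioo] with s hs using hg0 s hs

/-! ### Raising the essential infimum by spreading mass. -/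

theorem torus_norm_coe_le (t : ℝ) : ‖(t : Torus)‖ ≤ |t| := by
  rw [UnitAddCircle.norm_eq]
  simpa using round_le t 0

theorem torus_coe_int (n : ℤ) : ((n : ℝ) : Torus) = 0 := by
  rw [AddCircle.coe_eq_zero_iff]; exact ⟨n, by simp⟩

/-- The bound `δ ≤ ‖x‖` keeps the pole out of the open segment; a pole at an endpoint makes the
right side infinite and does no harm. -/
theorem IsConvexKernel.exists_add_le_midpoint {w : Torus → ENNReal} (hw : IsConvexKernel w) :
    ∃ C : ℝ, 0 < C ∧ ∀ (x : Torus) (δ : ℝ), 0 < δ → δ ≤ ‖x‖ →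
      w x + ENNReal.ofReal (C * δ ^ 2) ≤
        ENNReal.ofReal (1 / 2) * w (x - (δ : Torus)) +
        ENNReal.ofReal (1 / 2) * w (x + (δ : Torus)) := by
  obtain ⟨C, hC, hconv⟩ := hw.convex
  refine ⟨C, hC, fun x δ hδ hx => ?_⟩
  obtain ⟨ζ, rfl⟩ := QuotientAddGroup.mk_surjective x
  have := hconv (ζ - δ) (ζ + δ) (1 / 2) (1 / 2) (by linarith) (fun n hn => ?_) (by norm_num)
    (by norm_num) (by norm_num)
  · rw [show 1 / 2 * (ζ - δ) + 1 / 2 * (ζ + δ) = ζ by ring,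
      show C * (1 / 2) * (1 / 2) * (ζ + δ - (ζ - δ)) ^ 2 = C * δ ^ 2 by ring] at this
    exact this
  · have h1 : ‖((ζ - n : ℝ) : Torus)‖ < δ := (torus_norm_coe_le _).trans_lt
      (abs_lt.2 ⟨by linarith [hn.2], by linarith [hn.1]⟩)
    rw [AddCircle.coe_sub, torus_coe_int, sub_zero] at h1
    exact absurd hx (not_le.2 h1)

theorem kernelPotential_map_add {w : Torus → ENNReal} (hw : Continuous w) (ρ : Measure Torus)
    (a x : Torus) :
    kernelPotential w (ρ.map (fun y => y + a)) x = kernelPotential w ρ (x - a) := by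
  unfold kernelPotential
  rw [lintegral_map (f := fun y => w (x - y)) (hw.comp (by fun_prop)).measurable (by fun_prop)]
  exact lintegral_congr fun y => by rw [sub_sub, add_comm]

/-- If the potential exceeds its essential infimum at a point of the support, spreading some of
the mass near that point raises the essential infimum. -/
theorem exists_essInf_kernelPotential_lt {w : Torus → ENNReal} (hw : IsConvexKernel w)
    {ρ : Measure Torus} [IsProbabilityMeasure ρ] {x₀ : Torus} (hx₀ : x₀ ∈ ρ.support)
    (hpot : essInf (kernelPotential w ρ) volume < kernelPotential w ρ x₀) {I : Set Torus}
    (hI : MeasurableSet I) (hI' : I ∈ 𝓝 x₀ ∨ Iᶜ ∈ 𝓝 x₀) :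
    ∃ ρ' : Measure Torus, IsProbabilityMeasure ρ' ∧ ρ' I = ρ I ∧
      essInf (kernelPotential w ρ) volume < essInf (kernelPotential w ρ') volume := by
  set u := essInf (kernelPotential w ρ) volume with hu
  obtain ⟨C, hC, hmid⟩ := hw.exists_add_le_midpoint
  obtain ⟨b, hub, hb⟩ := exists_between hpot
  have hut : u ≠ ⊤ := hub.ne_top
  have hbt : b ≠ ⊤ := hb.ne_top
  have hlsc := lowerSemicontinuous_kernelPotential hw.continuous ρ x₀ b hb
  -- Lower semicontinuity gives a whole ball on which the potential exceeds `b > u`; shrinking puts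
  -- it on one side of `I`.
  obtain ⟨ε, hε, hεU, hεI⟩ : ∃ ε > 0, (∀ y ∈ Metric.ball x₀ ε, b < kernelPotential w ρ y) ∧
      (Metric.ball x₀ ε ⊆ I ∨ Metric.ball x₀ ε ⊆ Iᶜ) := by
    rcases hI' with h | h
    · obtain ⟨ε, hε, h'⟩ := Metric.eventually_nhds_iff_ball.1 (hlsc.and h)
      exact ⟨ε, hε, fun y hy => (h' y hy).1, Or.inl fun y hy => (h' y hy).2⟩
    · obtain ⟨ε, hε, h'⟩ := Metric.eventually_nhds_iff_ball.1 (hlsc.and h)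
      exact ⟨ε, hε, fun y hy => (h' y hy).1, Or.inr fun y hy => (h' y hy).2⟩
  set δ : ℝ := ε / 2 with hδ
  have hδ0 : 0 < δ := by positivity
  set B := Metric.ball x₀ δ with hB
  have hBm : MeasurableSet B := measurableSet_ball
  have hBpos : 0 < ρ B := Measure.mem_support_iff_forall x₀ |>.1 hx₀ B (Metric.ball_mem_nhds _ hδ0)
  -- The mass of the ball of radius `δ = ε / 2`, sent half to each side. It stays in the ball of
  -- radius `ε`, so the mass of `I` is preserved.
  set η : Measure Torus := ENNReal.ofReal (1 / 2) • (ρ.restrict B).map (fun y => y + (δ : Torus)) +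
    ENNReal.ofReal (1 / 2) • (ρ.restrict B).map (fun y => y + (-(δ : Torus))) with hη
  set σ : Measure Torus := ρ.restrict Bᶜ + η with hσ
  have half : ENNReal.ofReal (1 / 2) + ENNReal.ofReal (1 / 2) = 1 := by
    rw [← ENNReal.ofReal_add (by norm_num) (by norm_num)]; norm_num
  have hshift : ∀ y ∈ B, ∀ a : Torus, ‖a‖ ≤ δ → y + a ∈ Metric.ball x₀ ε := by
    intro y hy a ha
    rw [hB, Metric.mem_ball, dist_eq_norm] at hy
    rw [Metric.mem_ball, dist_eq_norm, add_sub_right_comm]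
    exact (norm_add_le _ _).trans_lt (by linarith)
  have hδn : ‖(δ : Torus)‖ ≤ δ := (torus_norm_coe_le δ).trans_eq (abs_of_pos hδ0)
  have hmass : ∀ T : Set Torus, MeasurableSet T →
      (Metric.ball x₀ ε ⊆ T ∨ Metric.ball x₀ ε ⊆ Tᶜ) → σ T = ρ T := by
    intro T hT hT'
    have hone : ∀ a : Torus, ‖a‖ ≤ δ → (ρ.restrict B).map (fun y => y + a) T = ρ (T ∩ B) := by
      intro a ha
      rw [Measure.map_apply (by fun_prop) hT, Measure.restrict_apply (by measurability)]
      congr 1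
      ext y
      simp only [mem_inter_iff, mem_preimage]
      refine and_congr_left fun hy => ?_
      have h1 := hshift y hy a ha
      have h2 : y ∈ Metric.ball x₀ ε := by simpa using hshift y hy 0 (by simpa using hδ0.le)
      rcases hT' with h | h
      · exact iff_of_true (h h1) (h h2)
      · exact iff_of_false (h h1) (h h2)
    rw [hσ, hη, Measure.add_apply, Measure.add_apply, Measure.smul_apply, Measure.smul_apply,
      hone _ hδn, hone _ (by rwa [norm_neg]), smul_eq_mul, ← add_mul, half, one_mul,
      Measure.restrict_apply hT, ← sdiff_eq, measure_sdiff_add_inter _ hBm]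
  have hσ1 : σ univ = 1 := by
    rw [hmass univ MeasurableSet.univ (Or.inl (subset_univ _)), measure_univ]
  -- Outside the larger ball, `y - z` is at distance at least `δ` from the pole for every moved `z`,
  -- so the midpoint inequality applies with a uniform gain.
  have hfar : ∀ y ∉ Metric.ball x₀ ε,
      kernelPotential w ρ y + ENNReal.ofReal (C * δ ^ 2) * ρ B ≤ kernelPotential w σ y := by
    intro y hy
    have e1 : kernelPotential w ρ y =
        kernelPotential w (ρ.restrict Bᶜ) y + kernelPotential w (ρ.restrict B) y := by
      rw [← kernelPotential_add, add_comm, Measure.restrict_add_restrict_compl hBm]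
    rw [e1, hσ, kernelPotential_add, add_assoc]
    refine add_le_add_right ?_ _
    rw [hη, kernelPotential_add, kernelPotential_smul, kernelPotential_smul,
      kernelPotential_map_add hw.continuous, kernelPotential_map_add hw.continuous, sub_neg_eq_add]
    have hm : ∀ x : Torus, Measurable fun z => w (x - z) := fun x =>
      (hw.continuous.comp (by fun_prop)).measurable
    unfold kernelPotential
    rw [← setLIntegral_const, ← lintegral_add_left (hm _), ← lintegral_const_mul _ (hm _),
      ← lintegral_const_mul _ (hm _), ← lintegral_add_left ((hm _).const_mul _)]
    refine setLIntegral_mono' hBm fun z hz => ?_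
    have := hmid (y - z) δ hδ0 ?_
    · rwa [sub_right_comm, sub_add_eq_add_sub] at this
    · rw [Metric.mem_ball, dist_eq_norm] at hy hz
      have : ‖y - x₀‖ ≤ ‖y - z‖ + ‖z - x₀‖ := norm_sub_le_norm_sub_add_norm_sub _ _ _
      linarith
  have hab : u.toReal < b.toReal := (ENNReal.toReal_lt_toReal hut hbt).2 hub
  have hu0 : 0 ≤ u.toReal := ENNReal.toReal_nonneg
  -- Chosen so that `(1 - t) b = (u + b) / 2 > u`: inside the ball the retained share of `ρ` alone
  -- keeps the potential above `u`.
  set t : ℝ := (b.toReal - u.toReal) / (2 * b.toReal) with ht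
  have hb0 : 0 < b.toReal := hu0.trans_lt hab
  have ht0 : 0 < t := div_pos (by linarith) (by linarith)
  have ht1 : t < 1 := by rw [ht, div_lt_one (by linarith)]; linarith
  have hpq : ENNReal.ofReal (1 - t) + ENNReal.ofReal t = 1 := by
    rw [← ENNReal.ofReal_add (by linarith) ht0.le]; simp
  have htb : u < ENNReal.ofReal (1 - t) * b := by
    rw [← ENNReal.ofReal_toReal hut, ← ENNReal.ofReal_toReal hbt,
      ← ENNReal.ofReal_mul (by linarith)]
    rw [ENNReal.ofReal_lt_ofReal_iff']
    have e : (1 - t) * b.toReal = (u.toReal + b.toReal) / 2 := by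
      rw [ht]; field_simp; ring
    rw [e]
    constructor <;> linarith
  refine ⟨ENNReal.ofReal (1 - t) • ρ + ENNReal.ofReal t • σ, ⟨?_⟩, ?_, ?_⟩
  · simp [hσ1, hpq]
  · simp only [Measure.add_apply, Measure.smul_apply, smul_eq_mul]
    rw [hmass I hI hεI, ← add_mul, hpq, one_mul]
  · set κ := ENNReal.ofReal t * (ENNReal.ofReal (C * δ ^ 2) * ρ B) with hκ
    have hκ0 : κ ≠ 0 := by
      refine mul_ne_zero (by simpa using ht0) (mul_ne_zero ?_ hBpos.ne')
      rw [Ne, ENNReal.ofReal_eq_zero, not_le]; positivity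
    refine lt_of_lt_of_le (lt_min htb (ENNReal.lt_add_right hut hκ0)) ?_
    refine le_essInf_of_ae_le _ ?_
    filter_upwards [ae_essInf_le_kernelPotential w ρ] with y hy
    rw [kernelPotential_add, kernelPotential_smul, kernelPotential_smul]
    by_cases hyb : y ∈ Metric.ball x₀ ε
    · refine (min_le_left _ _).trans (le_trans ?_ le_self_add)
      exact mul_le_mul_right (hεU y hyb).le _
    · refine (min_le_right _ _).trans ?_
      calc u + κ ≤ kernelPotential w ρ y + κ := add_le_add_left hy _
        _ = ENNReal.ofReal (1 - t) * kernelPotential w ρ y + ENNReal.ofReal t *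
            (kernelPotential w ρ y + ENNReal.ofReal (C * δ ^ 2) * ρ B) := by
            rw [mul_add, ← add_assoc, ← add_mul, hpq, one_mul]
        _ ≤ _ := add_le_add_right (mul_le_mul_right (hfar y hyb) _) _

/-! ### Structure of the support. -/

theorem isCompact_closedArc (a b : ℝ) : IsCompact (closedArc a b) :=
  isCompact_Icc.image (AddCircle.continuous_mk' 1)

theorem measurableSet_closedArc (a b : ℝ) : MeasurableSet (closedArc a b) :=
  (isCompact_closedArc a b).isClosed.measurableSet

theorem torus_coe_inj {s t : ℝ} (h : |s - t| < 1) (hst : (s : Torus) = t) : s = t := by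
  have : ((s - t : ℝ) : Torus) = 0 := by rw [AddCircle.coe_sub, hst, sub_self]
  rw [AddCircle.coe_eq_zero_iff] at this
  obtain ⟨n, hn⟩ := this
  simp only [zsmul_eq_mul, mul_one] at hn
  rw [← hn] at h
  have h1 : |n| < 1 := by exact_mod_cast h
  rw [Int.abs_lt_one_iff.1 h1] at hn
  simp only [Int.cast_zero] at hn
  linarith

theorem closedArc_mem_nhds_or {M : ℝ} {x : Torus} (h1 : x ≠ (M : Torus))
    (h2 : x ≠ ((-M : ℝ) : Torus)) :
    closedArc (-M) M ∈ 𝓝 x ∨ (closedArc (-M) M)ᶜ ∈ 𝓝 x := by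
  by_cases hx : x ∈ closedArc (-M) M
  · left
    obtain ⟨t, ht, rfl⟩ := hx
    have ht' : t ∈ Ioo (-M) M := ⟨lt_of_le_of_ne ht.1 (by rintro rfl; exact h2 rfl),
      lt_of_le_of_ne ht.2 (by rintro rfl; exact h1 rfl)⟩
    refine mem_of_superset ((QuotientAddGroup.isOpenMap_coe _ isOpen_Ioo).mem_nhds
      (mem_image_of_mem _ ht')) (image_mono Ioo_subset_Icc_self)
  · right
    exact (isCompact_closedArc _ _).isClosed.isOpen_compl.mem_nhds hx

/-- A point between two points of a closed set of reals but outside that set lies in a gap. -/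
theorem exists_gap {F : Set ℝ} (hF : IsClosed F) {a b t : ℝ} (ha : a ∈ F) (hb : b ∈ F)
    (hat : a ≤ t) (htb : t ≤ b) (ht : t ∉ F) :
    ∃ a' ∈ F, ∃ b' ∈ F, a ≤ a' ∧ b' ≤ b ∧ a' < b' ∧ ∀ s ∈ Ioo a' b', s ∉ F := by
  have h1 : IsCompact (F ∩ Icc a t) := isCompact_Icc.inter_left hF
  have h2 : IsCompact (F ∩ Icc t b) := isCompact_Icc.inter_left hF
  obtain ⟨a', ha', hmax⟩ := h1.exists_isGreatest ⟨a, ha, le_rfl, hat⟩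
  obtain ⟨b', hb', hmin⟩ := h2.exists_isLeast ⟨b, hb, htb, le_rfl⟩
  refine ⟨a', ha'.1, b', hb'.1, ha'.2.1, hb'.2.2, ?_, ?_⟩
  · refine lt_of_le_of_lt ha'.2.2 (lt_of_le_of_ne hb'.2.1 ?_)
    rintro rfl; exact ht hb'.1
  · intro s hs hsF
    rcases le_total s t with h | h
    · exact not_le.2 hs.1 (hmax ⟨hsF, ha'.2.1.trans hs.1.le, h⟩)
    · exact not_le.2 hs.2 (hmin ⟨hsF, h, hs.2.le.trans hb'.2.2⟩)

/-- On the line, a compact set without gaps fills the segment from its minimum to its maximum. Since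
`c ∉ F` the minimum exceeds `c`, which makes the length strictly less than one. -/
theorem isClosedInterval_inter_closedArc {F : Set Torus} (hF : IsClosed F) {c d : ℝ}
    (hcd : d ≤ c + 1) (hc : (c : Torus) ∉ F)
    (hgap : ∀ a b : ℝ, c ≤ a → a < b → b ≤ d → (a : Torus) ∈ F → (b : Torus) ∈ F →
      ∃ s ∈ Ioo a b, (s : Torus) ∈ F) : IsClosedInterval (F ∩ closedArc c d) := by
  set G : Set ℝ := (fun t : ℝ => (t : Torus)) ⁻¹' F with hG
  have hGc : IsClosed G := hF.preimage (AddCircle.continuous_mk' 1)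
  have himg : F ∩ closedArc c d = (fun t : ℝ => (t : Torus)) '' (G ∩ Icc c d) := by
    rw [closedArc, hG, image_preimage_inter]
  rw [himg]
  have hcomp : IsCompact (G ∩ Icc c d) := isCompact_Icc.inter_left hGc
  rcases (G ∩ Icc c d).eq_empty_or_nonempty with h | h
  · left; rw [h, image_empty]
  right
  obtain ⟨a, ha, hmin⟩ := hcomp.exists_isLeast h
  obtain ⟨b, hb, hmax⟩ := hcomp.exists_isGreatest h
  have hca : c < a := lt_of_le_of_ne ha.2.1 (by rintro rfl; exact hc ha.1)
  refine ⟨a, b, hmin hb, by linarith [hb.2.2], ?_⟩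
  rw [closedArc]
  congr 1
  refine Subset.antisymm (fun t ht => ⟨hmin ht, hmax ht⟩) fun t ht => ?_
  refine ⟨by_contra fun htG => ?_, hca.le.trans ht.1, ht.2.trans hb.2.2⟩
  obtain ⟨a', ha', b', hb', h1, h2, h3, h4⟩ := exists_gap hGc ha.1 hb.1 ht.1 ht.2 htG
  obtain ⟨s, hs, hsF⟩ := hgap a' b' (hca.le.trans h1) h3 (h2.trans hb.2.2) ha' hb'
  exact h4 s hs hsF

theorem isClosed_sublevel_kernelPotential {w : Torus → ENNReal} (hw : Continuous w)
    (ρ : Measure Torus) (u : ENNReal) : IsClosed {x | kernelPotential w ρ x ≤ u} :=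
  (lowerSemicontinuous_kernelPotential hw ρ).isClosed_preimage u

/-- A measure whose potential is at most its essential infimum on the whole support, up to a null
set, is Lebesgue measure. -/
theorem eq_volume_of_le_essInf {w : Torus → ENNReal} (hw : IsConvexKernel w)
    (ρ : Measure Torus) [IsProbabilityMeasure ρ] {P : Set Torus} (hP : ρ P = 0)
    (hsed : ∀ x ∈ ρ.support, x ∉ P →
      kernelPotential w ρ x ≤ essInf (kernelPotential w ρ) volume) : ρ = volume := by
  set u := essInf (kernelPotential w ρ) volume with hu
  have hAcl := isClosed_sublevel_kernelPotential hw.continuous ρ u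
  set A := {x | kernelPotential w ρ x ≤ u} with hA
  have hAc : ρ Aᶜ = 0 := by
    refine measure_mono_null (t := ρ.supportᶜ ∪ P) (fun x hx => ?_)
      (measure_union_null Measure.measure_compl_support hP)
    by_contra h
    simp only [mem_union, mem_compl_iff, not_or, not_not] at h
    exact hx (hsed x h.1 h.2)
  have hAne : A.Nonempty := by
    by_contra h
    rw [not_nonempty_iff_eq_empty] at h
    rw [h, compl_empty, measure_univ] at hAc
    exact one_ne_zero hAc
  -- A missing point would lie in a gap of the closed set `A`, found on the line between a point of
  -- `A` and its translate by one turn. The gap has no mass, against `measure_arc_ne_zero`.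
  have hAu : ∀ x, x ∈ A := by
    intro x
    by_contra hx
    obtain ⟨t, rfl⟩ := QuotientAddGroup.mk_surjective x
    obtain ⟨y, hy⟩ := hAne
    obtain ⟨a, ha, rfl⟩ := (AddCircle.coe_image_Ioc_eq (1 : ℝ) (t - 1)).symm ▸ mem_univ y
    have ha2 : a ≤ t := by linarith [ha.2]
    have hb : (fun t : ℝ => (t : Torus)) (a + 1) ∈ A := by
      simp only [torus_coe_add_one]; exact hy
    obtain ⟨a', ha', b', hb', h1, h2, h3, h4⟩ := exists_gap
      (hAcl.preimage (AddCircle.continuous_mk' 1)) hy hb ha2 (by linarith [ha.1]) hx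
    refine measure_arc_ne_zero hw ρ h3 ha' hb' (measure_mono_null ?_ hAc)
    rintro _ ⟨s, hs, rfl⟩
    exact h4 s hs
  have hκ : ∫⁻ x, kernelPotential w ρ x = ∫⁻ x, w x := by
    rw [lintegral_kernelPotential_volume hw, measure_univ, mul_one]
  have huκ : u ≤ ∫⁻ x, w x := by
    rw [← hκ]
    calc u = ∫⁻ _ : Torus, u := by simp
      _ ≤ _ := lintegral_mono_ae (ae_essInf_le_kernelPotential w ρ)
  have hE : ∫⁻ x, kernelPotential w ρ x ∂ρ ≤ ∫⁻ x, w x := by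
    calc _ ≤ ∫⁻ _, u ∂ρ := lintegral_mono fun x => hAu x
      _ = u := by simp
      _ ≤ _ := huκ
  have hvol : ∫⁻ x, kernelPotential w volume x = ∫⁻ x, w x := by
    simp [kernelPotential_volume]
  -- The energy of Lebesgue measure and its mutual energy with `ρ` both equal `∫ w`, and the energy
  -- of `ρ` is at most `∫ w`.
  refine measure_eq_of_energy_le hw (ne_top_of_le_ne_top hw.lintegral_ne_top hE)
    (hvol.trans_ne hw.lintegral_ne_top) ?_
  rw [hvol, hκ, two_mul]
  exact add_le_add_left hE _

theorem volume_closedArc_le (a b : ℝ) : volume (closedArc a b) ≤ ENNReal.ofReal (b - a) := by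
  have hsub : closedArc a b ⊆ Metric.closedBall (((a + b) / 2 : ℝ) : Torus) ((b - a) / 2) := by
    rintro _ ⟨t, ht, rfl⟩
    rw [Metric.mem_closedBall, dist_eq_norm]
    simp only
    rw [← AddCircle.coe_sub]
    exact (torus_norm_coe_le _).trans (abs_le.2 ⟨by linarith [ht.1], by linarith [ht.2]⟩)
  refine (measure_mono hsub).trans ?_
  rw [AddCircle.volume_closedBall]
  exact ENNReal.ofReal_le_ofReal ((min_le_right _ _).trans (by linarith))

/-- For `M = 0` the two Dirac masses coincide, and the factor `1/2` splits the single atom between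
them. -/
theorem restrict_pair_eq_smul_dirac {ρ : Measure Torus} [IsFiniteMeasure ρ]
    (heven : ρ.map (fun x => -x) = ρ) {M : ℝ} (hM : 0 ≤ M) (hM' : M < 1 / 2) :
    ρ.restrict {(M : Torus), ((-M : ℝ) : Torus)} =
      ENNReal.ofReal (ρ.real {(M : Torus), ((-M : ℝ) : Torus)} / 2) •
        (Measure.dirac (M : Torus) + Measure.dirac ((-M : ℝ) : Torus)) := by
  rcases hM.eq_or_lt with rfl | hpos
  · simp only [neg_zero, pair_eq_singleton, Measure.restrict_singleton]
    rw [← two_smul ENNReal, smul_smul, mul_comm, ENNReal.ofReal_div_of_pos (by norm_num),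
      ENNReal.ofReal_ofNat, ENNReal.mul_div_cancel (by simp) (by simp), ofReal_measureReal]
  · have hne : (M : Torus) ≠ ((-M : ℝ) : Torus) := fun h => by
      have := torus_coe_inj (abs_lt.2 ⟨by linarith, by linarith⟩) h
      linarith
    have hsym : ρ {((-M : ℝ) : Torus)} = ρ {(M : Torus)} := by
      conv_lhs => rw [← heven]
      rw [Measure.map_apply (by fun_prop) (measurableSet_singleton _)]
      congr 1
      ext x
      simp
    have hd : Disjoint {(M : Torus)} {((-M : ℝ) : Torus)} := disjoint_singleton.2 hne
    rw [insert_eq, measureReal_union hd (measurableSet_singleton _),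
      Measure.restrict_union hd (measurableSet_singleton _), Measure.restrict_singleton,
      Measure.restrict_singleton, measureReal_def, measureReal_def, hsym, add_self_div_two,
      ENNReal.ofReal_toReal (measure_ne_top _ _), smul_add]

/-- Atoms have infinite potential, while the rest of the support lies in a closed sublevel set.
Hence each atom has a neighbourhood that the remaining measure does not charge. -/
theorem support_restrict_compl_eq {w : Torus → ENNReal} (hw : IsConvexKernel w)
    (ρ : Measure Torus) [IsProbabilityMeasure ρ] {P : Set Torus} (hP : IsClosed P)
    (hatom : ∀ x ∈ P, ρ {x} ≠ 0)
    (hsed : ∀ x ∈ ρ.support, x ∉ P →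
      kernelPotential w ρ x ≤ essInf (kernelPotential w ρ) volume) :
    (ρ.restrict Pᶜ).support = ρ.support \ P := by
  set u := essInf (kernelPotential w ρ) volume with hu
  have hut : u ≠ ⊤ := essInf_kernelPotential_ne_top hw ρ
  have hPA : ∀ x ∈ P, ¬ kernelPotential w ρ x ≤ u := fun x hx h => by
    rw [kernelPotential_eq_top hw (hatom x hx), top_le_iff] at h
    exact hut h
  have hAcl := isClosed_sublevel_kernelPotential hw.continuous ρ u
  refine Subset.antisymm (fun x hx => ⟨?_, fun hxP => ?_⟩) fun x hx => ?_
  · exact Measure.support_mono Measure.restrict_le_self hx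
  · have h1 := (Measure.mem_support_iff_forall x).1 hx _
      (hAcl.isOpen_compl.mem_nhds (hPA x hxP))
    rw [Measure.restrict_apply hAcl.measurableSet.compl] at h1
    refine h1.ne' (measure_mono_null (t := ρ.supportᶜ) ?_ Measure.measure_compl_support)
    exact fun y hy hys => hy.1 (hsed y hys hy.2)
  · rw [Measure.mem_support_iff_forall]
    intro U hU
    have h1 := (Measure.mem_support_iff_forall x).1 hx.1 (U ∩ Pᶜ)
      (inter_mem hU (hP.isOpen_compl.mem_nhds hx.2))
    exact h1.trans_le (Measure.le_restrict_apply _ _)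

/-- Here `m` is half the mass of `{M, -M}`, and `J`, `K` are the parts of the remaining support
outside and inside the arc. That support avoids `±M`, so `K` is a proper subset. -/
theorem exists_decomposition {w : Torus → ENNReal} (hw : IsConvexKernel w)
    (ρ : Measure Torus) [IsProbabilityMeasure ρ] (heven : ρ.map (fun x => -x) = ρ) {M : ℝ}
    (hM : 0 ≤ M) (hM' : M < 1 / 2) (hne : ρ ≠ volume)
    (hsed : ∀ x ∈ ρ.support, x ≠ (M : Torus) → x ≠ ((-M : ℝ) : Torus) →
      kernelPotential w ρ x ≤ essInf (kernelPotential w ρ) volume) :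
    ∃ (m : ℝ) (ρ₁ : Measure Torus) (J K : Set Torus),
        0 < m ∧ m ≤ 1 / 2 ∧
        ρ = ENNReal.ofReal m •
            (Measure.dirac (M : Torus) + Measure.dirac ((-M : ℝ) : Torus)) + ρ₁ ∧
        ρ₁ univ = ENNReal.ofReal (1 - 2 * m) ∧
        IsClosedInterval J ∧ IsClosedInterval K ∧
        J ⊂ (closedArc (-M) M)ᶜ ∧ K ⊂ closedArc (-M) M ∧
        ρ₁.support = J ∪ K := by
  set P : Set Torus := {(M : Torus), ((-M : ℝ) : Torus)} with hPdef
  have hPfin : P.Finite := toFinite _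
  have hPm : MeasurableSet P := hPfin.measurableSet
  have hsed' : ∀ x ∈ ρ.support, x ∉ P →
      kernelPotential w ρ x ≤ essInf (kernelPotential w ρ) volume := fun x hx hxP => by
    simp only [hPdef, mem_insert_iff, mem_singleton_iff, not_or] at hxP
    exact hsed x hx hxP.1 hxP.2
  have hP0 : ρ P ≠ 0 := fun h => hne (eq_volume_of_le_essInf hw ρ h hsed')
  have hrestr := restrict_pair_eq_smul_dirac heven hM hM'
  rw [← hPdef] at hrestr
  set m := ρ.real P / 2 with hm
  have hPr : 0 < ρ.real P := ENNReal.toReal_pos hP0 (measure_ne_top _ _)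
  have hm0 : 0 < m := half_pos hPr
  have hatom : ∀ x ∈ P, ρ {x} ≠ 0 := by
    intro x hx
    have h1 : ρ.restrict P {x} ≠ 0 := by
      rw [hrestr]
      simp only [Measure.smul_apply, Measure.add_apply, smul_eq_mul]
      refine mul_ne_zero (by simpa using hm0) ?_
      simp only [hPdef, mem_insert_iff, mem_singleton_iff] at hx
      rcases hx with rfl | rfl <;> simp
    exact fun h => h1 (le_antisymm ((Measure.restrict_apply_le _ _).trans h.le) bot_le)
  have hsupp := support_restrict_compl_eq hw ρ hPfin.isClosed hatom hsed'
  have hFcl : IsClosed (ρ.restrict Pᶜ).support := Measure.isClosed_support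
  set F := (ρ.restrict Pᶜ).support with hF
  have hFP : ∀ x ∈ P, x ∉ F := fun x hx h => (hsupp ▸ h).2 hx
  have hMP : (M : Torus) ∈ P := by simp [hPdef]
  have hMP' : ((-M : ℝ) : Torus) ∈ P := by simp [hPdef]
  have hFsed : ∀ x ∈ F, kernelPotential w ρ x ≤ essInf (kernelPotential w ρ) volume :=
    fun x hx => hsed' x (hsupp ▸ hx).1 (hsupp ▸ hx).2
  -- An open arc between two points of `F` carries mass; if it avoids `±M`, it therefore contains a
  -- point of `F`.
  have hgap : ∀ a b : ℝ, a < b → (∀ s ∈ Ioo a b, (s : Torus) ∉ P) → (a : Torus) ∈ F →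
      (b : Torus) ∈ F → ∃ s ∈ Ioo a b, (s : Torus) ∈ F := by
    intro a b hab hs ha hb
    have h0 := measure_arc_ne_zero hw ρ hab (hFsed _ ha) (hFsed _ hb)
    obtain ⟨_, ⟨s, hs', rfl⟩, hsS⟩ := Measure.nonempty_inter_support_of_pos h0.bot_lt
    exact ⟨s, hs', hsupp ▸ ⟨hsS, hs s hs'⟩⟩
  have hcover : (closedArc (-M) M)ᶜ ⊆ closedArc M (1 - M) := by
    intro x hx
    obtain ⟨t, ht, rfl⟩ := (AddCircle.coe_image_Ioc_eq (1 : ℝ) (-M)).symm ▸ mem_univ x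
    rcases le_or_gt t M with h | h
    · exact absurd ⟨t, ⟨ht.1.le, h⟩, rfl⟩ hx
    · exact ⟨t, ⟨h.le, by linarith [ht.2]⟩, rfl⟩
  have hM1 : ((1 - M : ℝ) : Torus) = ((-M : ℝ) : Torus) := by
    rw [sub_eq_neg_add, torus_coe_add_one]
  -- As `F` avoids `±M`, the open complementary arc may be replaced by its closure.
  have hJeq : F ∩ (closedArc (-M) M)ᶜ = F ∩ closedArc M (1 - M) := by
    refine Subset.antisymm (inter_subset_inter_right _ hcover) ?_
    rintro _ ⟨hx, t, ht, rfl⟩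
    refine ⟨hx, ?_⟩
    rintro ⟨s, hs, hst⟩
    simp only at hst hx
    have h1 : M < t := lt_of_le_of_ne ht.1 (by rintro rfl; exact hFP _ hMP hx)
    have h2 : t < 1 - M := lt_of_le_of_ne ht.2 (by rintro rfl; exact hFP _ hMP' (hM1 ▸ hx))
    have := torus_coe_inj (abs_lt.2 ⟨by linarith [hs.1], by linarith [hs.2]⟩) hst
    linarith [hs.2]
  refine ⟨m, ρ.restrict Pᶜ, F ∩ (closedArc (-M) M)ᶜ, F ∩ closedArc (-M) M, hm0, ?_, ?_, ?_, ?_,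
    ?_, ?_, ?_, ?_⟩
  · have : ρ.real P ≤ 1 := measureReal_le_one
    linarith
  · rw [← hrestr, Measure.restrict_add_restrict_compl hPm]
  · rw [Measure.restrict_apply_univ, prob_compl_eq_one_sub hPm, hm, mul_div_cancel₀ _ two_ne_zero,
      ENNReal.ofReal_sub _ hPr.le, ofReal_measureReal, ENNReal.ofReal_one]
  · rw [hJeq]
    refine isClosedInterval_inter_closedArc hFcl (by linarith) (hFP _ hMP) ?_
    intro a b ha hab hb
    refine hgap a b hab fun s hs hsP => ?_
    simp only [hPdef, mem_insert_iff, mem_singleton_iff] at hsP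
    rcases hsP with h | h
    · have := torus_coe_inj (abs_lt.2 ⟨by linarith [hs.1], by linarith [hs.2]⟩) h
      linarith [hs.1]
    · rw [← hM1] at h
      have := torus_coe_inj (abs_lt.2 ⟨by linarith [hs.1], by linarith [hs.2]⟩) h
      linarith [hs.2]
  · refine isClosedInterval_inter_closedArc hFcl (by linarith) (hFP _ hMP') ?_
    intro a b ha hab hb
    refine hgap a b hab fun s hs hsP => ?_
    simp only [hPdef, mem_insert_iff, mem_singleton_iff] at hsP
    rcases hsP with h | h
    · have := torus_coe_inj (abs_lt.2 ⟨by linarith [hs.1], by linarith [hs.2]⟩) h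
      linarith [hs.2]
    · have := torus_coe_inj (abs_lt.2 ⟨by linarith [hs.1], by linarith [hs.2]⟩) h
      linarith [hs.1]
  -- If `J` were the whole complement, the arc would be clopen in a connected space; yet it contains
  -- `M` and misses `1/2`.
  · refine ⟨inter_subset_right, fun h => ?_⟩
    have heq : F ∩ (closedArc (-M) M)ᶜ = (closedArc (-M) M)ᶜ :=
      Subset.antisymm inter_subset_right h
    have hcl : IsClosed (closedArc (-M) M)ᶜ := by
      rw [← heq, hJeq]; exact hFcl.inter (isCompact_closedArc _ _).isClosed
    have hclopen : IsClopen (closedArc (-M) M) :=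
      ⟨(isCompact_closedArc _ _).isClosed, isClosed_compl_iff.1 hcl⟩
    rcases isClopen_iff.1 hclopen with h' | h'
    · exact (h' ▸ (⟨M, ⟨by linarith, le_rfl⟩, rfl⟩ : (M : Torus) ∈ closedArc (-M) M) :
        (M : Torus) ∈ (∅ : Set Torus))
    · obtain ⟨s, hs, hs2⟩ := h'.symm ▸ mem_univ (((1 / 2 : ℝ)) : Torus)
      have := torus_coe_inj (abs_lt.2 ⟨by linarith [hs.1], by linarith [hs.2]⟩) hs2
      linarith [hs.2]
  · refine ⟨inter_subset_right, fun h => ?_⟩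
    exact hFP _ hMP (h ⟨M, ⟨by linarith, le_rfl⟩, rfl⟩).1
  · rw [← inter_union_distrib_left, compl_union_self, inter_univ]

/-! ### Uniqueness for prescribed masses at `±M`. -/

theorem setLIntegral_closedBall_sub (w : Torus → ENNReal) (x z : Torus) (r : ℝ) :
    ∫⁻ y in Metric.closedBall x r, w (y - z) = ∫⁻ y in Metric.closedBall (x - z) r, w y := by
  rw [← lintegral_indicator measurableSet_closedBall,
    ← lintegral_indicator measurableSet_closedBall,
    ← lintegral_sub_right_eq_self (fun y => (Metric.closedBall (x - z) r).indicator w y) z]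
  refine lintegral_congr fun y => ?_
  simp [indicator, dist_eq_norm]

/-- If the averages of the kernel are controlled by the kernel, then the essential infimum of a
potential is a lower bound everywhere. -/
theorem essInf_le_kernelPotential {w : Torus → ENNReal} (hw : IsConvexKernel w) {K c : ENNReal}
    (hK : K ≠ ⊤) (hc : c ≠ ⊤)
    (havg : ∀ r : ℝ, 0 < r → r < 1 / 2 → ∀ x,
      (ENNReal.ofReal (2 * r))⁻¹ * ∫⁻ y in Metric.closedBall x r, w y ≤ K * w x + c)
    (ρ : Measure Torus) [IsProbabilityMeasure ρ] (x : Torus) :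
    essInf (kernelPotential w ρ) volume ≤ kernelPotential w ρ x := by
  by_cases hx : kernelPotential w ρ x = ⊤
  · rw [hx]; exact le_top
  set u := essInf (kernelPotential w ρ) volume with hu
  have hw2 : Measurable fun p : Torus × Torus => w (p.1 - p.2) :=
    (hw.continuous.comp (by fun_prop)).measurable
  obtain ⟨r, -, hr, hr0⟩ := exists_seq_strictAnti_tendsto' (show (0 : ℝ) < 1 / 2 by norm_num)
  have hr0' : Tendsto r atTop (𝓝[>] 0) :=
    tendsto_nhdsWithin_iff.2 ⟨hr0, Eventually.of_forall fun n => (hr n).1⟩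
  have hmeas : ∀ s : ℝ, Measurable fun z => ∫⁻ y in Metric.closedBall x s, w (y - z) := fun s =>
    Measurable.lintegral_prod_left' hw2
  -- Dominated convergence: `havg` supplies the majorant `K w(x - z) + c`, integrable because the
  -- potential at `x` is finite.
  have hlim : Tendsto (fun n => ∫⁻ z, (ENNReal.ofReal (2 * r n))⁻¹ *
      (∫⁻ y in Metric.closedBall x (r n), w (y - z)) ∂ρ) atTop (𝓝 (kernelPotential w ρ x)) := by
    refine tendsto_lintegral_of_dominated_convergence (fun z => K * w (x - z) + c)
      (fun n => (hmeas _).const_mul _) (fun n => Eventually.of_forall fun z => ?_) ?_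
      (Eventually.of_forall fun z => ?_)
    · simp_rw [setLIntegral_closedBall_sub]
      exact havg _ (hr n).1 (hr n).2 _
    · rw [lintegral_add_right _ measurable_const, lintegral_const_mul' _ _ hK]
      exact ENNReal.add_ne_top.2 ⟨ENNReal.mul_ne_top hK hx, by simpa using hc⟩
    · simp_rw [setLIntegral_closedBall_sub]
      exact (tendsto_laverage_closedBall hw.continuous.continuousAt).comp hr0'
  -- After swapping the integrals, each term is the average over a ball of a potential that is at
  -- least `u` almost everywhere.
  refine ge_of_tendsto hlim (Eventually.of_forall fun n => ?_)
  have hr1 : 0 < ENNReal.ofReal (2 * r n) := by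
    rw [ENNReal.ofReal_pos]; linarith [(hr n).1]
  rw [lintegral_const_mul _ (hmeas _), lintegral_lintegral_swap
    (f := fun z y => w (y - z)) (hw2.comp measurable_swap).aemeasurable]
  calc u = (ENNReal.ofReal (2 * r n))⁻¹ * ∫⁻ _ in Metric.closedBall x (r n), u := by
        rw [setLIntegral_const, volume_torus_closedBall x (hr n).2.le, mul_comm u, ← mul_assoc,
          ENNReal.inv_mul_cancel hr1.ne' ENNReal.ofReal_ne_top, one_mul]
    _ ≤ _ := mul_le_mul_right (lintegral_mono_ae
        (ae_restrict_of_ae (ae_essInf_le_kernelPotential w ρ))) _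

/-- Two probability measures which agree on a set `P`, with potentials minimal on the rest of the
respective supports, are equal. -/
theorem measure_eq_of_sediment {w : Torus → ENNReal} (hw : IsConvexKernel w)
    {μ ρ : Measure Torus} [IsProbabilityMeasure μ] [IsProbabilityMeasure ρ] {P : Set Torus}
    (hP : MeasurableSet P) (hμρ : μ.restrict P = ρ.restrict P)
    (hμ' : ∀ x, essInf (kernelPotential w μ) volume ≤ kernelPotential w μ x)
    (hρ' : ∀ x, essInf (kernelPotential w ρ) volume ≤ kernelPotential w ρ x)
    (hμ : ∀ x ∈ μ.support, x ∉ P → kernelPotential w μ x ≤ essInf (kernelPotential w μ) volume)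
    (hρ : ∀ x ∈ ρ.support, x ∉ P → kernelPotential w ρ x ≤ essInf (kernelPotential w ρ) volume) :
    μ = ρ := by
  set α := μ.restrict Pᶜ with hα
  set β := ρ.restrict Pᶜ with hβ
  set κ := ρ.restrict P with hκ
  have hμe : μ = κ + α := by rw [← hμρ, hα, Measure.restrict_add_restrict_compl hP]
  have hρe : ρ = κ + β := by rw [hκ, hβ, Measure.restrict_add_restrict_compl hP]
  have hαβ : α univ = β univ := by
    have hPP : μ P = ρ P := by
      rw [← Measure.restrict_apply_self, hμρ, hκ, Measure.restrict_apply_self]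
    rw [hα, hβ, Measure.restrict_apply_univ, Measure.restrict_apply_univ,
      prob_compl_eq_one_sub hP, prob_compl_eq_one_sub hP, hPP]
  have hae : ∀ (ν : Measure Torus) [IsProbabilityMeasure ν],
      (∀ x ∈ ν.support, x ∉ P → kernelPotential w ν x ≤ essInf (kernelPotential w ν) volume) →
      ∫⁻ x, kernelPotential w ν x ∂(ν.restrict Pᶜ) ≤
        essInf (kernelPotential w ν) volume * ν.restrict Pᶜ univ := by
    intro ν _ hν
    rw [← lintegral_const]
    refine lintegral_mono_ae ?_
    filter_upwards [ae_restrict_of_ae (Measure.support_mem_ae (μ := ν)),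
      ae_restrict_mem hP.compl] with x h1 h2 using hν x h1 h2
  have hlow : ∀ (ν γ : Measure Torus),
      (∀ x, essInf (kernelPotential w ν) volume ≤ kernelPotential w ν x) →
      essInf (kernelPotential w ν) volume * γ univ ≤ ∫⁻ x, kernelPotential w ν x ∂γ := by
    intro ν γ hν
    rw [← lintegral_const]
    exact lintegral_mono hν
  have hm := fun ν : Measure Torus => measurable_kernelPotential hw.continuous ν
  have split : ∀ (γ δ : Measure Torus), ∫⁻ x, kernelPotential w (κ + γ) x ∂δ =
      ∫⁻ x, kernelPotential w κ x ∂δ + ∫⁻ x, kernelPotential w γ x ∂δ := by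
    intro γ δ
    simp_rw [kernelPotential_add]
    rw [lintegral_add_left (hm κ)]
  have h1 := hae μ hμ
  have h2 := hae ρ hρ
  have hfin1 := ne_top_of_le_ne_top (ENNReal.mul_ne_top (essInf_kernelPotential_ne_top hw μ)
    (measure_ne_top α univ)) h1
  have hfin2 := ne_top_of_le_ne_top (ENNReal.mul_ne_top (essInf_kernelPotential_ne_top hw ρ)
    (measure_ne_top β univ)) h2
  -- The potential of `μ` is at most its essential infimum `α`-almost everywhere and at least that
  -- value everywhere. As `α` and `β` have equal mass, its integral against `α` is at most that
  -- against `β`; `h4` exchanges the roles.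
  have h3 := h1.trans ((congrArg _ hαβ).trans_le (hlow μ β hμ'))
  have h4 := h2.trans ((congrArg _ hαβ.symm).trans_le (hlow ρ α hρ'))
  have e1 : ∀ δ : Measure Torus, ∫⁻ x, kernelPotential w μ x ∂δ =
      ∫⁻ x, kernelPotential w κ x ∂δ + ∫⁻ x, kernelPotential w α x ∂δ := fun δ => by
    rw [← split, ← hμe]
  have e2 : ∀ δ : Measure Torus, ∫⁻ x, kernelPotential w ρ x ∂δ =
      ∫⁻ x, kernelPotential w κ x ∂δ + ∫⁻ x, kernelPotential w β x ∂δ := fun δ => by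
    rw [← split, ← hρe]
  rw [← hα, e1] at hfin1
  rw [← hβ, e2] at hfin2
  rw [← hα, e1, e1] at h3
  rw [← hβ, e2, e2, lintegral_kernelPotential_comm hw β α] at h4
  rw [ENNReal.add_ne_top] at hfin1 hfin2
  have heq : α = β := by
    refine measure_eq_of_energy_le hw hfin1.2 hfin2.2 ?_
    -- Adding the two comparisons, the finite terms with the common part `κ` cancel.
    refine ENNReal.le_of_add_le_add_left (ENNReal.add_ne_top.2 ⟨hfin1.1, hfin2.1⟩) ?_
    calc _ = (∫⁻ x, kernelPotential w κ x ∂α + ∫⁻ x, kernelPotential w α x ∂α) +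
          (∫⁻ x, kernelPotential w κ x ∂β + ∫⁻ x, kernelPotential w β x ∂β) := by ring
      _ ≤ _ := add_le_add h3 h4
      _ = _ := by ring
  rw [hμe, hρe, heq]

/-! ### Discrepancy, symmetrization and existence of minimizers. -/

theorem bddAbove_excess (ρ : Measure Torus) [IsProbabilityMeasure ρ] :
    BddAbove {s : ℝ | ∃ a b : ℝ, a ≤ b ∧ b < a + 1 ∧ s = excess ρ a b} := by
  refine ⟨1, ?_⟩
  rintro _ ⟨a, b, hab, -, rfl⟩
  have : ρ.real (closedArc a b) ≤ 1 := measureReal_le_one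
  rw [excess]; linarith

theorem excess_le_discrepancy (ρ : Measure Torus) [IsProbabilityMeasure ρ] {a b : ℝ}
    (hab : a ≤ b) (hb : b < a + 1) : excess ρ a b ≤ discrepancy ρ :=
  le_csSup (bddAbove_excess ρ) ⟨a, b, hab, hb, rfl⟩

theorem discrepancy_le {ρ : Measure Torus} {D : ℝ}
    (h : ∀ a b : ℝ, a ≤ b → b < a + 1 → excess ρ a b ≤ D) : discrepancy ρ ≤ D := by
  refine csSup_le ⟨_, 0, 0, le_rfl, by norm_num, rfl⟩ ?_
  rintro _ ⟨a, b, hab, hb, rfl⟩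
  exact h a b hab hb

theorem discrepancy_le_one (ρ : Measure Torus) [IsProbabilityMeasure ρ] : discrepancy ρ ≤ 1 := by
  refine discrepancy_le fun a b hab _ => ?_
  have : ρ.real (closedArc a b) ≤ 1 := measureReal_le_one
  rw [excess]; linarith

theorem closedArc_add (a b c : ℝ) :
    closedArc (a + c) (b + c) = (fun x => x - (c : Torus)) ⁻¹' closedArc a b := by
  ext x
  obtain ⟨t, rfl⟩ := QuotientAddGroup.mk_surjective x
  constructor
  · rintro ⟨s, hs, hst⟩
    refine ⟨s - c, ⟨by linarith [hs.1], by linarith [hs.2]⟩, ?_⟩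
    simp only at hst ⊢
    rw [AddCircle.coe_sub, hst]
  · rintro ⟨s, hs, hst⟩
    refine ⟨s + c, ⟨by linarith [hs.1], by linarith [hs.2]⟩, ?_⟩
    simp only at hst ⊢
    rw [AddCircle.coe_add, hst, sub_add_cancel]

theorem closedArc_neg (a b : ℝ) : closedArc (-b) (-a) = (fun x => -x) ⁻¹' closedArc a b := by
  ext x
  constructor
  · rintro ⟨s, hs, rfl⟩
    exact ⟨-s, ⟨by linarith [hs.2], by linarith [hs.1]⟩, AddCircle.coe_neg ..⟩
  · rintro ⟨s, hs, hst⟩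
    refine ⟨-s, ⟨by linarith [hs.2], by linarith [hs.1]⟩, ?_⟩
    simp only at hst ⊢
    rw [AddCircle.coe_neg, hst, neg_neg]

/-- Upper semicontinuity of the mass of a closed arc, jointly in the measure and the arc. -/
theorem eventually_measure_closedArc_lt {ι : Type*} {l : Filter ι}
    {ρs : ι → ProbabilityMeasure Torus} {ρ : ProbabilityMeasure Torus} (hρ : Tendsto ρs l (𝓝 ρ))
    {as bs : ι → ℝ} {a b : ℝ} (ha : Tendsto as l (𝓝 a)) (hb : Tendsto bs l (𝓝 b)) (hab : a ≤ b)
    {c : ENNReal} (hc : (ρ : Measure Torus) (closedArc a b) < c) :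
    ∀ᶠ i in l, (ρs i : Measure Torus) (closedArc (as i) (bs i)) < c := by
  -- By outer regularity and compactness, all nearby arcs lie in one closed arc of `ρ`-mass below
  -- `c`, to which the portmanteau theorem applies.
  obtain ⟨U, hU, hUo, hUc⟩ := (closedArc a b).exists_isOpen_lt_of_lt c hc
  have hVo : IsOpen ((fun t : ℝ => (t : Torus)) ⁻¹' U) := hUo.preimage (AddCircle.continuous_mk' 1)
  obtain ⟨δ, hδ, hδU⟩ := isCompact_Icc.exists_cthickening_subset_open hVo
    (image_subset_iff.1 hU)
  have hF : closedArc (a - δ) (b + δ) ⊆ U := by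
    refine image_subset_iff.2 fun s hs => hδU ?_
    refine Metric.mem_cthickening_of_dist_le s (max a (min s b)) δ _
      ⟨le_max_left _ _, max_le hab (min_le_right _ _)⟩ ?_
    rw [Real.dist_eq, abs_le]
    simp only [max_def, min_def]
    split_ifs <;> constructor <;> linarith [hs.1, hs.2]
  have h1 : ∀ᶠ i in l, (ρs i : Measure Torus) (closedArc (a - δ) (b + δ)) < c := by
    refine eventually_lt_of_limsup_lt (lt_of_le_of_lt
      (ProbabilityMeasure.limsup_measure_closed_le_of_tendsto hρ (isCompact_closedArc _ _).isClosed)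
      ((measure_mono hF).trans_lt hUc))
  filter_upwards [h1, ha.eventually (lt_mem_nhds (sub_lt_self a hδ)),
    hb.eventually (gt_mem_nhds (lt_add_of_pos_right b hδ))] with i hi hai hbi
  exact (measure_mono (image_mono (Icc_subset_Icc hai.le hbi.le))).trans_lt hi

theorem le_excess_of_tendsto {ι : Type*} {l : Filter ι} [l.NeBot]
    {ρs : ι → ProbabilityMeasure Torus} {ρ : ProbabilityMeasure Torus} (hρ : Tendsto ρs l (𝓝 ρ))
    {as bs : ι → ℝ} {a b : ℝ} (ha : Tendsto as l (𝓝 a)) (hb : Tendsto bs l (𝓝 b)) (hab : a ≤ b)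
    {D : ℝ} (hD : Tendsto (fun i => excess (ρs i) (as i) (bs i)) l (𝓝 D)) :
    D ≤ excess ρ a b := by
  refine le_of_forall_pos_le_add fun ε hε => ?_
  have hfin : ENNReal.ofReal ((ρ : Measure Torus).real (closedArc a b) + ε) ≠ ⊤ :=
    ENNReal.ofReal_ne_top
  have h0 : 0 ≤ (ρ : Measure Torus).real (closedArc a b) := measureReal_nonneg
  have hev := eventually_measure_closedArc_lt hρ ha hb hab
    (c := ENNReal.ofReal ((ρ : Measure Torus).real (closedArc a b) + ε)) (by
      rw [← ofReal_measureReal]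
      exact (ENNReal.ofReal_lt_ofReal_iff (by linarith)).2 (by linarith))
  have hlim : Tendsto (fun i => (ρ : Measure Torus).real (closedArc a b) + ε - (bs i - as i)) l
      (𝓝 ((ρ : Measure Torus).real (closedArc a b) + ε - (b - a))) :=
    tendsto_const_nhds.sub (hb.sub ha)
  have := le_of_tendsto_of_tendsto hD hlim (by
    filter_upwards [hev] with i hi
    rw [excess]
    have := ENNReal.toReal_mono hfin hi.le
    rw [ENNReal.toReal_ofReal (by linarith)] at this
    exact sub_le_sub_right this _)
  rw [excess]; linarith

/-- Upper semicontinuity with a constant sequence of measures. A limiting arc of length one would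
have nonpositive excess, and `hD` excludes this. -/
theorem exists_discrepancy_eq_excess (ρ : Measure Torus) [IsProbabilityMeasure ρ]
    (hD : 0 < discrepancy ρ) :
    ∃ a b : ℝ, a ≤ b ∧ b < a + 1 ∧ discrepancy ρ = excess ρ a b := by
  obtain ⟨s, -, hs, hsmem⟩ := exists_seq_tendsto_sSup
    (S := {s : ℝ | ∃ a b : ℝ, a ≤ b ∧ b < a + 1 ∧ s = excess ρ a b})
    ⟨_, 0, 0, le_rfl, by norm_num, rfl⟩ (bddAbove_excess ρ)
  choose a b hab hb hsab using hsmem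
  -- Integer translations bring the left endpoints into `[0, 1)`, so that the arcs range over a
  -- compact set.
  have hper : ∀ n, excess ρ (Int.fract (a n)) (b n - ⌊a n⌋) = s n := by
    intro n
    rw [hsab, excess, excess, ← Int.self_sub_floor]
    have := closedArc_add (a n - ⌊a n⌋) (b n - ⌊a n⌋) ⌊a n⌋
    simp only [torus_coe_int, sub_zero, sub_add_cancel, preimage_id'] at this
    rw [this]; ring
  have hfr : ∀ n, Int.fract (a n) = a n - ⌊a n⌋ := fun n => rfl
  have hmem : ∀ n, (Int.fract (a n), b n - ⌊a n⌋) ∈ Icc (0 : ℝ) 1 ×ˢ Icc (0 : ℝ) 2 := by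
    intro n
    have h1 := Int.fract_nonneg (a n)
    have h2 := (Int.fract_lt_one (a n)).le
    refine ⟨⟨h1, h2⟩, ?_, ?_⟩ <;> simp only <;> linarith [hfr n, hab n, hb n]
  obtain ⟨⟨p, q⟩, -, φ, hφ, hlim⟩ := (isCompact_Icc.prod isCompact_Icc).tendsto_subseq hmem
  have hp := (continuous_fst.tendsto _).comp hlim
  have hq := (continuous_snd.tendsto _).comp hlim
  have hpq : p ≤ q := le_of_tendsto_of_tendsto' hp hq fun n => by
    simp only [Function.comp]; linarith [hfr (φ n), hab (φ n)]
  have hqp : q ≤ p + 1 := le_of_tendsto_of_tendsto' hq (hp.add_const 1) fun n => by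
    simp only [Function.comp]; linarith [hfr (φ n), hb (φ n)]
  have hle : discrepancy ρ ≤ excess ρ p q := by
    refine le_excess_of_tendsto (l := atTop) (ρs := fun _ : ℕ => ⟨ρ, inferInstance⟩)
      (ρ := ⟨ρ, inferInstance⟩) tendsto_const_nhds hp hq hpq ?_
    have := hs.comp hφ.tendsto_atTop
    refine this.congr fun n => ?_
    simp only [Function.comp]
    exact (hper (φ n)).symm
  have hlt : q < p + 1 := by
    refine lt_of_le_of_ne hqp ?_
    rintro rfl
    have : ρ.real (closedArc p (p + 1)) ≤ 1 := measureReal_le_one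
    rw [excess] at hle
    linarith
  exact ⟨p, q, hpq, hlt, le_antisymm hle (excess_le_discrepancy ρ hpq hlt)⟩

theorem excess_map_sub (ρ : Measure Torus) (a b c : ℝ) :
    excess (ρ.map fun x => x - (c : Torus)) a b = excess ρ (a + c) (b + c) := by
  rw [excess, excess, closedArc_add, map_measureReal_apply (by fun_prop)
    (measurableSet_closedArc a b)]
  ring

theorem excess_map_neg (ρ : Measure Torus) (a b : ℝ) :
    excess (ρ.map fun x => -x) a b = excess ρ (-b) (-a) := by
  rw [excess, excess, closedArc_neg, map_measureReal_apply (by fun_prop)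
    (measurableSet_closedArc a b)]
  ring

theorem kernelPotential_map_neg {w : Torus → ENNReal} (hw : IsConvexKernel w) (ρ : Measure Torus)
    (x : Torus) : kernelPotential w (ρ.map (fun y => -y)) x = kernelPotential w ρ (-x) := by
  unfold kernelPotential
  rw [lintegral_map (f := fun y => w (x - y)) (hw.continuous.comp (by fun_prop)).measurable
    (by fun_prop)]
  exact lintegral_congr fun y => by rw [← hw.even]; congr 1; abel

/-- Centring and symmetrization: the discrepancy is kept, and the essential infimum of the
potential does not decrease. -/
theorem exists_even_of_discrepancy_pos {w : Torus → ENNReal} (hw : IsConvexKernel w)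
    (ρ : Measure Torus) [IsProbabilityMeasure ρ] (hD : 0 < discrepancy ρ) :
    ∃ (σ : Measure Torus) (M : ℝ), IsProbabilityMeasure σ ∧ σ.map (fun x => -x) = σ ∧ 0 ≤ M ∧
      M < 1 / 2 ∧ discrepancy σ = excess σ (-M) M ∧ discrepancy σ = discrepancy ρ ∧
      essInf (kernelPotential w ρ) volume ≤ essInf (kernelPotential w σ) volume := by
  obtain ⟨a, b, hab, hb, heq⟩ := exists_discrepancy_eq_excess ρ hD
  set c := (a + b) / 2 with hc
  set M := (b - a) / 2 with hM
  set τ := ρ.map fun x => x - (c : Torus) with hτ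
  have hτp : IsProbabilityMeasure τ := Measure.isProbabilityMeasure_map (by fun_prop)
  have hτn : IsProbabilityMeasure (τ.map fun x => -x) :=
    Measure.isProbabilityMeasure_map (by fun_prop)
  have half : ENNReal.ofReal (1 / 2) + ENNReal.ofReal (1 / 2) = 1 := by
    rw [← ENNReal.ofReal_add (by norm_num) (by norm_num)]; norm_num
  set σ := ENNReal.ofReal (1 / 2) • τ + ENNReal.ofReal (1 / 2) • τ.map fun x => -x with hσ
  have hσp : IsProbabilityMeasure σ := ⟨by simp [hσ, half, -one_div]⟩
  -- Each excess of `σ` is a mean of two excesses of `ρ`. On `[-M, M]` both come from the optimal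
  -- arc `[a, b]`.
  have hexc : ∀ p q : ℝ, excess σ p q = (excess ρ (p + c) (q + c) +
      excess ρ (-q + c) (-p + c)) / 2 := by
    intro p q
    rw [← excess_map_sub, ← excess_map_sub, ← hτ, ← excess_map_neg]
    rw [hσ, excess, excess, excess, measureReal_add_apply
      (ENNReal.mul_ne_top ENNReal.ofReal_ne_top (measure_ne_top _ _))
      (ENNReal.mul_ne_top ENNReal.ofReal_ne_top (measure_ne_top _ _)),
      measureReal_ennreal_smul_apply,
      measureReal_ennreal_smul_apply, ENNReal.toReal_ofReal (by norm_num)]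
    ring
  have hσD : discrepancy σ ≤ discrepancy ρ := by
    refine discrepancy_le fun p q hpq hq => ?_
    rw [hexc]
    have h1 := excess_le_discrepancy ρ (a := p + c) (b := q + c) (by linarith) (by linarith)
    have h2 := excess_le_discrepancy ρ (a := -q + c) (b := -p + c) (by linarith) (by linarith)
    linarith
  have hσM : excess σ (-M) M = discrepancy ρ := by
    rw [hexc, heq, neg_neg, show -M + c = a by rw [hM, hc]; ring,
      show M + c = b by rw [hM, hc]; ring]
    ring
  have hDeq : discrepancy σ = discrepancy ρ := le_antisymm hσD
    (hσM ▸ excess_le_discrepancy σ (by linarith) (by linarith))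
  refine ⟨σ, M, hσp, ?_, by linarith, by linarith, hDeq.trans hσM.symm, hDeq, ?_⟩
  · have : (τ.map fun x => -x).map (fun x => -x) = τ := by
      rw [Measure.map_map (by fun_prop) (by fun_prop)]
      have : ((fun x : Torus => -x) ∘ fun x : Torus => -x) = id := by ext x; simp
      rw [this, Measure.map_id]
    rw [hσ, Measure.map_add _ _ (by fun_prop), Measure.map_smul, Measure.map_smul, this, add_comm]
  -- The potential of `σ` at `x` is the mean of that of `ρ` at `c + x` and `c - x`, and both maps
  -- preserve null sets.
  · refine le_essInf_of_ae_le _ ?_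
    have h0 := ae_essInf_le_kernelPotential w ρ
    have h1 := (measurePreserving_add_right (volume : Measure Torus)
      (c : Torus)).quasiMeasurePreserving.ae h0
    have h2 := (Measure.measurePreserving_neg (volume : Measure Torus)).quasiMeasurePreserving.ae h1
    filter_upwards [h1, h2] with x hx1 hx2
    have hτU : ∀ y, kernelPotential w τ y = kernelPotential w ρ (y + c) := fun y => by
      simp_rw [hτ, sub_eq_add_neg]
      rw [kernelPotential_map_add hw.continuous, sub_neg_eq_add]
    rw [hσ, kernelPotential_add, kernelPotential_smul, kernelPotential_smul,
      kernelPotential_map_neg hw, hτU, hτU]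
    calc _ = ENNReal.ofReal (1 / 2) * essInf (kernelPotential w ρ) volume +
          ENNReal.ofReal (1 / 2) * essInf (kernelPotential w ρ) volume := by
          rw [← add_mul, half, one_mul]
      _ ≤ _ := add_le_add (mul_le_mul_right hx1 _) (mul_le_mul_right hx2 _)

theorem lintegral_mul_kernelPotential {w : Torus → ENNReal} (hw : IsConvexKernel w)
    (ρ : Measure Torus) [IsFiniteMeasure ρ] {φ : Torus → ENNReal} (hφ : Measurable φ) :
    ∫⁻ x, φ x * kernelPotential w ρ x = ∫⁻ y, (∫⁻ x, φ (x + y) * w x) ∂ρ := by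
  have hw2 : Measurable fun p : Torus × Torus => w (p.1 - p.2) :=
    (hw.continuous.comp (by fun_prop)).measurable
  have e1 : ∀ x, φ x * kernelPotential w ρ x = ∫⁻ y, φ x * w (x - y) ∂ρ := fun x =>
    (lintegral_const_mul _ (hw2.comp measurable_prodMk_left)).symm
  simp_rw [e1]
  rw [lintegral_lintegral_swap (f := fun x y => φ x * w (x - y))
    ((hφ.comp measurable_fst).mul hw2).aemeasurable]
  refine lintegral_congr fun y => ?_
  rw [← lintegral_add_right_eq_self (fun x => φ x * w (x - y)) y]
  simp

/-- This makes integrals of potentials against continuous weights accessible to weak convergence.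
Dominated convergence with majorant `w`; the pole is discarded as a null set because multiplication
by `⊤` is not continuous. -/
theorem exists_boundedContinuous_convolution {w : Torus → ENNReal} (hw : IsConvexKernel w)
    {φ : Torus → ENNReal} (hφ : Continuous φ) (hφ1 : ∀ x, φ x ≤ 1) :
    ∃ ψ : BoundedContinuousFunction Torus NNReal,
      ∀ y, (ψ y : ENNReal) = ∫⁻ x, φ (x + y) * w x := by
  have hfin : ∀ y, ∫⁻ x, φ (x + y) * w x ≠ ⊤ := fun y =>
    ne_top_of_le_ne_top hw.lintegral_ne_top (lintegral_mono fun x =>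
      (mul_le_mul_left (hφ1 _) _).trans_eq (one_mul _))
  have hcont : Continuous fun y => ∫⁻ x, φ (x + y) * w x := by
    refine continuous_iff_continuousAt.2 fun y => ?_
    refine tendsto_lintegral_filter_of_dominated_convergence w
      (Eventually.of_forall fun y => ?_) (Eventually.of_forall fun y =>
        Eventually.of_forall fun x => (mul_le_mul_left (hφ1 _) _).trans_eq (one_mul _))
      hw.lintegral_ne_top ?_
    · exact ((hφ.comp (by fun_prop)).measurable).mul hw.continuous.measurable
    · have h0 : ∀ᵐ x : Torus, x ≠ 0 := by
        have := volume_torus_closedBall 0 (show (0 : ℝ) ≤ 1 / 2 by norm_num)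
        rw [Metric.closedBall_zero, mul_zero, ENNReal.ofReal_zero] at this
        simpa [ae_iff] using this
      filter_upwards [h0] with x hx
      exact ENNReal.Tendsto.mul_const ((hφ.comp (by fun_prop : Continuous fun y => x + y)).tendsto y)
        (Or.inr (hw.ne_top x hx))
  have hc' : Continuous fun y => (∫⁻ x, φ (x + y) * w x).toNNReal :=
    continuous_iff_continuousAt.2 fun y =>
      (ENNReal.tendsto_toNNReal (hfin y)).comp (hcont.tendsto y)
  exact ⟨BoundedContinuousFunction.mkOfCompact ⟨_, hc'⟩, fun y => ENNReal.coe_toNNReal (hfin y)⟩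

/-- The essential infimum of the potential is upper semicontinuous in the measure. -/
theorem le_essInf_kernelPotential_of_tendsto {w : Torus → ENNReal} (hw : IsConvexKernel w)
    {ι : Type*} {l : Filter ι} [l.NeBot]
    {ρs : ι → ProbabilityMeasure Torus} {ρ : ProbabilityMeasure Torus} (hρ : Tendsto ρs l (𝓝 ρ))
    {u : ENNReal} (hu : Tendsto (fun i => essInf (kernelPotential w (ρs i)) volume) l (𝓝 u)) :
    u ≤ essInf (kernelPotential w ρ) volume := by
  have hUm := measurable_kernelPotential hw.continuous (ρ : Measure Torus)
  -- Against a continuous weight the bound passes to the limit, since the weight can be convolved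
  -- with `w` and moved onto the measures.
  have htest : ∀ φ : Torus → ENNReal, Continuous φ → (∀ x, φ x ≤ 1) →
      u * ∫⁻ x, φ x ≤ ∫⁻ x, φ x * kernelPotential w ρ x := by
    intro φ hφ hφ1
    obtain ⟨ψ, hψ⟩ := exists_boundedContinuous_convolution hw hφ hφ1
    have hint : ∀ σ : Measure Torus, IsFiniteMeasure σ →
        ∫⁻ x, φ x * kernelPotential w σ x = ∫⁻ y, (ψ y : ENNReal) ∂σ := by
      intro σ _
      rw [lintegral_mul_kernelPotential hw σ hφ.measurable]
      simp_rw [hψ]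
    have hφt : ∫⁻ x, φ x ≠ ⊤ :=
      ne_top_of_le_ne_top (b := 1) (by simp) ((lintegral_mono hφ1).trans_eq (by simp))
    have h1 := (ProbabilityMeasure.tendsto_iff_forall_lintegral_tendsto.1 hρ) ψ
    have h2 : Tendsto (fun i => essInf (kernelPotential w (ρs i)) volume * ∫⁻ x, φ x) l
        (𝓝 (u * ∫⁻ x, φ x)) := ENNReal.Tendsto.mul_const hu (Or.inr hφt)
    rw [hint ρ inferInstance]
    refine le_of_tendsto_of_tendsto' h2 h1 fun i => ?_
    rw [← hint (ρs i) inferInstance, ← lintegral_const_mul _ hφ.measurable]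
    refine lintegral_mono_ae ?_
    filter_upwards [ae_essInf_le_kernelPotential w (ρs i)] with x hx
    rw [mul_comm]
    exact mul_le_mul_right hx _
  have hUfin : ∫⁻ x, kernelPotential w ρ x ≠ ⊤ := by
    rw [lintegral_kernelPotential_volume hw, measure_univ, mul_one]
    exact hw.lintegral_ne_top
  -- Thickened indicators decrease to the indicator of a closed set; inner regularity then reaches
  -- all measurable sets.
  have hclosed : ∀ F : Set Torus, IsClosed F →
      u * volume F ≤ ∫⁻ x in F, kernelPotential w ρ x := by
    intro F hF
    obtain ⟨δ, -, hδ, hδ0⟩ := exists_seq_strictAnti_tendsto (0 : ℝ)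
    set φ : ℕ → Torus → ENNReal := fun n x => (thickenedIndicator (hδ n) F x : ENNReal) with hφ
    have hφc : ∀ n, Continuous (φ n) := fun n =>
      ENNReal.continuous_coe.comp (thickenedIndicator (hδ n) F).continuous
    have hφ1 : ∀ n x, φ n x ≤ 1 := fun n x => by
      exact ENNReal.coe_le_one_iff.2 (thickenedIndicator_le_one (hδ n) F x)
    have hlim : ∀ x, Tendsto (fun n => φ n x) atTop (𝓝 (F.indicator (fun _ => 1) x)) := by
      intro x
      have h1 := tendsto_pi_nhds.1 (thickenedIndicator_tendsto_indicator_closure hδ hδ0 F) x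
      rw [hF.closure_eq] at h1
      have h2 := (ENNReal.continuous_coe.tendsto _).comp h1
      convert! h2 using 2
      by_cases hx : x ∈ F <;> simp [hx]
    have h1 : Tendsto (fun n => ∫⁻ x, φ n x * kernelPotential w ρ x) atTop
        (𝓝 (∫⁻ x in F, kernelPotential w ρ x)) := by
      rw [← lintegral_indicator hF.measurableSet]
      refine tendsto_lintegral_of_dominated_convergence _ (fun n => (hφc n).measurable.mul hUm)
        (fun n => Eventually.of_forall fun x => (mul_le_mul_left (hφ1 n x) _).trans_eq (one_mul _))
        hUfin ?_
      filter_upwards [ae_lt_top hUm hUfin] with x hx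
      have := ENNReal.Tendsto.mul_const (hlim x) (Or.inr hx.ne)
      convert! this using 2
      by_cases hx : x ∈ F <;> simp [hx]
    refine ge_of_tendsto h1 (Eventually.of_forall fun n => le_trans ?_ (htest _ (hφc n) (hφ1 n)))
    refine mul_le_mul_right ?_ _
    rw [← lintegral_indicator_one hF.measurableSet]
    refine lintegral_mono fun x => ?_
    by_cases hx : x ∈ F
    · rw [hφ]; simp only; rw [thickenedIndicator_one (hδ n) F hx]; simp [hx]
    · simp [hx]
  refine le_essInf_of_ae_le _ ?_
  refine ae_le_of_forall_setLIntegral_le_of_sigmaFinite measurable_const fun s hs _ => ?_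
  rw [setLIntegral_const, hs.measure_eq_iSup_isClosed_of_ne_top (measure_ne_top _ _)]
  simp_rw [ENNReal.mul_iSup]
  refine iSup_le fun F => iSup_le fun hFs => iSup_le fun hF => ?_
  exact (hclosed F hF).trans (lintegral_mono_set hFs)

theorem essInf_kernelPotential_le {w : Torus → ENNReal} (hw : IsConvexKernel w)
    (ρ : Measure Torus) [IsProbabilityMeasure ρ] :
    essInf (kernelPotential w ρ) volume ≤ ∫⁻ x, w x := by
  calc essInf (kernelPotential w ρ) volume
      = ∫⁻ _ : Torus, essInf (kernelPotential w ρ) volume := by simp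
    _ ≤ ∫⁻ x, kernelPotential w ρ x := lintegral_mono_ae (ae_essInf_le_kernelPotential w ρ)
    _ = _ := by rw [lintegral_kernelPotential_volume hw, measure_univ, mul_one]

/-- The height of a measure for a nonnegative kernel with finite integral. -/
def kernelHeight (w : Torus → ENNReal) (ρ : Measure Torus) : ℝ :=
  (∫⁻ x, w x).toReal - (essInf (kernelPotential w ρ) volume).toReal

theorem kernelHeight_nonneg {w : Torus → ENNReal} (hw : IsConvexKernel w)
    (ρ : Measure Torus) [IsProbabilityMeasure ρ] : 0 ≤ kernelHeight w ρ :=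
  sub_nonneg.2 (ENNReal.toReal_mono hw.lintegral_ne_top (essInf_kernelPotential_le hw ρ))

theorem kernelHeight_le {w : Torus → ENNReal} (hw : IsConvexKernel w)
    {ρ σ : Measure Torus} [IsProbabilityMeasure σ]
    (h : essInf (kernelPotential w ρ) volume ≤ essInf (kernelPotential w σ) volume) :
    kernelHeight w σ ≤ kernelHeight w ρ :=
  sub_le_sub_left (ENNReal.toReal_mono (essInf_kernelPotential_ne_top hw σ) h) _

theorem one_le_discrepancy_dirac_zero : 1 ≤ discrepancy (Measure.dirac (0 : Torus)) := by
  refine le_trans ?_ (excess_le_discrepancy (Measure.dirac (0 : Torus)) (a := 0) (b := 0) le_rfl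
    (by norm_num))
  have : (0 : Torus) ∈ closedArc 0 0 := ⟨0, ⟨le_rfl, le_rfl⟩, rfl⟩
  rw [excess, measureReal_def, Measure.dirac_apply' _ (measurableSet_closedArc 0 0)]
  simp [this]

/-- The direct method, on a minimizing sequence already symmetrized so that its optimal arcs are
`[-M, M]`. The limit may have larger discrepancy and larger essential infimum than the limiting
values; both only lower the quotient. -/
theorem exists_even_minimizer {w : Torus → ENNReal} (hw : IsConvexKernel w) {α d : ℝ}
    (hα : 0 ≤ α) (hd : 0 < d) (hd' : d ≤ 1) :
    ∃ (ρ : Measure Torus) (M : ℝ), IsProbabilityMeasure ρ ∧ d ≤ discrepancy ρ ∧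
      ρ.map (fun x => -x) = ρ ∧ 0 ≤ M ∧ M < 1 / 2 ∧ discrepancy ρ = excess ρ (-M) M ∧
      ∀ μ : Measure Torus, IsProbabilityMeasure μ → d ≤ discrepancy μ →
        kernelHeight w ρ / discrepancy ρ ^ α ≤ kernelHeight w μ / discrepancy μ ^ α := by
  -- Any minimizer can be symmetrized afterwards, so evenness need not survive the limit.
  suffices h : ∃ ρ : Measure Torus, IsProbabilityMeasure ρ ∧ d ≤ discrepancy ρ ∧
      ∀ μ : Measure Torus, IsProbabilityMeasure μ → d ≤ discrepancy μ →
        kernelHeight w ρ / discrepancy ρ ^ α ≤ kernelHeight w μ / discrepancy μ ^ α by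
    obtain ⟨ρ, hρ, hρd, hmin⟩ := h
    obtain ⟨σ, M, hσ, heven, hM, hM', hexc, hD, hle⟩ :=
      exists_even_of_discrepancy_pos hw ρ (hd.trans_le hρd)
    refine ⟨σ, M, hσ, hD ▸ hρd, heven, hM, hM', hexc, fun μ hμ hμd => ?_⟩
    refine le_trans ?_ (hmin μ hμ hμd)
    rw [hD]
    exact div_le_div_of_nonneg_right (kernelHeight_le hw hle)
      (Real.rpow_nonneg (hd.trans_le hρd).le _)
  set S : Set ℝ := {g | ∃ μ : Measure Torus, IsProbabilityMeasure μ ∧ d ≤ discrepancy μ ∧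
    g = kernelHeight w μ / discrepancy μ ^ α} with hS
  have hSne : S.Nonempty := ⟨_, Measure.dirac 0, inferInstance,
    hd'.trans one_le_discrepancy_dirac_zero, rfl⟩
  have hSb : BddBelow S := by
    refine ⟨0, ?_⟩
    rintro _ ⟨μ, hμ, hμd, rfl⟩
    exact div_nonneg (kernelHeight_nonneg hw μ) (Real.rpow_nonneg (hd.trans_le hμd).le _)
  obtain ⟨g, -, hg, hgS⟩ := exists_seq_tendsto_sInf hSne hSb
  choose μ hμ hμd hμg using hgS
  choose σ M hσ heven hM hM' hexc hD hle using fun n =>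
    haveI := hμ n
    exists_even_of_discrepancy_pos hw (μ n) (hd.trans_le (hμd n))
  set τ : ℕ → ProbabilityMeasure Torus := fun n => ⟨σ n, hσ n⟩ with hτ
  -- Along one ultrafilter the measures, arcs, discrepancies and essential infima all converge at
  -- once, without subsequences.
  set 𝒰 : Ultrafilter ℕ := hyperfilter ℕ with h𝒰
  have h𝒰le : (𝒰 : Filter ℕ) ≤ atTop := Nat.hyperfilter_le_atTop
  obtain ⟨ρ, -, hρ⟩ := isCompact_univ.ultrafilter_le_nhds (𝒰.map τ) (by simp)
  obtain ⟨M₀, hM₀, hMlim⟩ := (isCompact_Icc (a := (0 : ℝ)) (b := 1 / 2)).ultrafilter_le_nhds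
    (𝒰.map M) (by
      simp only [le_principal_iff, Ultrafilter.mem_coe, Ultrafilter.mem_map]
      exact Filter.univ_mem' fun n => ⟨hM n, (hM' n).le⟩)
  obtain ⟨D₀, hD₀, hDlim⟩ := (isCompact_Icc (a := d) (b := 1)).ultrafilter_le_nhds
    (𝒰.map fun n => discrepancy (σ n)) (by
      simp only [le_principal_iff, Ultrafilter.mem_coe, Ultrafilter.mem_map]
      exact Filter.univ_mem' fun n => ⟨(hμd n).trans_eq (hD n).symm, discrepancy_le_one _⟩)
  obtain ⟨u, hu, hulim⟩ := (isCompact_Icc (a := (0 : ENNReal))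
    (b := ∫⁻ x, w x)).ultrafilter_le_nhds
    (𝒰.map fun n => essInf (kernelPotential w (σ n)) volume) (by
      simp only [le_principal_iff, Ultrafilter.mem_coe, Ultrafilter.mem_map]
      exact Filter.univ_mem' fun n => ⟨bot_le, essInf_kernelPotential_le hw _⟩)
  have hρ' : Tendsto τ 𝒰 (𝓝 ρ) := hρ
  have hMlim' : Tendsto M 𝒰 (𝓝 M₀) := hMlim
  have hDlim' : Tendsto (fun n => discrepancy (σ n)) 𝒰 (𝓝 D₀) := hDlim
  have hulim' : Tendsto (fun n => essInf (kernelPotential w (σ n)) volume) 𝒰 (𝓝 u) := hulim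
  have hut : u ≠ ⊤ := ne_top_of_le_ne_top hw.lintegral_ne_top hu.2
  have hD0 : 0 < D₀ := hd.trans_le hD₀.1
  have hDexc : D₀ ≤ excess ρ (-M₀) M₀ := by
    refine le_excess_of_tendsto hρ' hMlim'.neg hMlim' (by linarith [hM₀.1]) ?_
    exact hDlim'.congr fun n => hexc n
  -- The limiting arc is not the full circle, since its excess is at least `D₀ > 0`.
  have hM₀' : M₀ < -M₀ + 1 := by
    have : (ρ : Measure Torus).real (closedArc (-M₀) M₀) ≤ 1 := measureReal_le_one
    rw [excess] at hDexc
    linarith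
  have hDρ : D₀ ≤ discrepancy (ρ : Measure Torus) :=
    hDexc.trans (excess_le_discrepancy _ (by linarith [hM₀.1]) hM₀')
  have huρ := le_essInf_kernelPotential_of_tendsto hw hρ' hulim'
  refine ⟨ρ, inferInstance, hD₀.1.trans hDρ, fun ν hν hνd => ?_⟩
  have hlim : Tendsto (fun n => kernelHeight w (σ n) / discrepancy (σ n) ^ α) 𝒰
      (𝓝 (((∫⁻ x, w x).toReal - u.toReal) / D₀ ^ α)) :=
    (tendsto_const_nhds.sub ((ENNReal.tendsto_toReal hut).comp hulim')).div
      (hDlim'.rpow_const (Or.inl hD0.ne')) (Real.rpow_pos_of_pos hD0 _).ne'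
  have hlim2 : ((∫⁻ x, w x).toReal - u.toReal) / D₀ ^ α ≤ sInf S := by
    refine le_of_tendsto_of_tendsto' hlim (hg.mono_left h𝒰le) fun n => ?_
    rw [hμg, hD]
    have := hσ n
    exact div_le_div_of_nonneg_right (kernelHeight_le hw (hle n))
      (Real.rpow_nonneg (hd.trans_le (hμd n)).le _)
  refine le_trans ?_ (hlim2.trans (csInf_le hSb ⟨ν, hν, hνd, rfl⟩))
  refine div_le_div₀ ?_ ?_ (Real.rpow_pos_of_pos hD0 _) (Real.rpow_le_rpow hD0.le hDρ hα)
  · exact sub_nonneg.2 (ENNReal.toReal_mono hw.lintegral_ne_top hu.2)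
  · exact sub_le_sub_left (ENNReal.toReal_mono (essInf_kernelPotential_ne_top hw _) huρ) _

/-! ### The kernel obtained from an admissible potential. -/

/-- The value of a potential at the antipode of the origin, which is its minimum. -/
def potentialMin (W : Torus → EReal) : ℝ := (W ((1 / 2 : ℝ) : Torus)).toReal

/-- The potential shifted by its minimum. -/
def shiftedKernel (W : Torus → EReal) (x : Torus) : ENNReal :=
  (W x - (potentialMin W : EReal)).toENNReal

/-- The periodic function on the line given by a potential. -/
def periodicLift (W : Torus → EReal) (t : ℝ) : ℝ := (W (t : Torus)).toReal

namespace IsAdmissiblePotential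

variable {W : Torus → EReal}

theorem coe_periodicLift (hW : IsAdmissiblePotential W) {t : ℝ} (ht : (t : Torus) ≠ 0) :
    W (t : Torus) = (periodicLift W t : EReal) :=
  (EReal.coe_toReal (hW.real_valued _ ht).1 (hW.real_valued _ ht).2).symm

theorem coe_ne_zero_of_mem_Ioo {t : ℝ} (ht : t ∈ Ioo (0 : ℝ) 1) : (t : Torus) ≠ 0 := by
  intro h
  have := torus_coe_inj (t := 0) (abs_lt.2 ⟨by linarith [ht.1], by linarith [ht.2]⟩)
    (by simpa using h)
  exact ht.1.ne' this

theorem isOpen_coe_ne_zero : IsOpen {t : ℝ | (t : Torus) ≠ 0} :=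
  isOpen_compl_singleton.preimage (AddCircle.continuous_mk' 1)

theorem periodicLift_sub_int (W : Torus → EReal) (t : ℝ) (n : ℤ) :
    periodicLift W (t - n) = periodicLift W t := by
  rw [periodicLift, AddCircle.coe_sub, torus_coe_int, sub_zero, periodicLift]

theorem periodicLift_one_sub (hW : IsAdmissiblePotential W) (t : ℝ) :
    periodicLift W (1 - t) = periodicLift W t := by
  rw [periodicLift, sub_eq_neg_add, torus_coe_add_one, AddCircle.coe_neg, hW.even, periodicLift]

theorem hasDerivAt_periodicLift (hW : IsAdmissiblePotential W) {t : ℝ} (ht : (t : Torus) ≠ 0) :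
    HasDerivAt (periodicLift W) (deriv (periodicLift W) t) t := by
  have h : DifferentiableOn ℝ (periodicLift W) {t : ℝ | (t : Torus) ≠ 0} :=
    hW.contDiffOn.differentiableOn (by norm_num)
  exact (h.differentiableAt (isOpen_coe_ne_zero.mem_nhds ht)).hasDerivAt

theorem contDiffOn_deriv (hW : IsAdmissiblePotential W) :
    ContDiffOn ℝ 1 (deriv (periodicLift W)) {t : ℝ | (t : Torus) ≠ 0} :=
  ((contDiffOn_succ_iff_deriv_of_isOpen (n := 1) isOpen_coe_ne_zero).1
    (by simpa [one_add_one_eq_two] using! hW.contDiffOn)).2.2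

theorem hasDerivAt_deriv_periodicLift (hW : IsAdmissiblePotential W) {t : ℝ}
    (ht : (t : Torus) ≠ 0) :
    HasDerivAt (deriv (periodicLift W)) (deriv (deriv (periodicLift W)) t) t :=
  ((hW.contDiffOn_deriv.differentiableOn (by norm_num)).differentiableAt
    (isOpen_coe_ne_zero.mem_nhds ht)).hasDerivAt

theorem continuousOn_deriv_deriv (hW : IsAdmissiblePotential W) :
    ContinuousOn (deriv (deriv (periodicLift W))) {t : ℝ | (t : Torus) ≠ 0} :=
  hW.contDiffOn_deriv.continuousOn_deriv_of_isOpen isOpen_coe_ne_zero le_rfl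

/-- Symmetry under `t ↦ 1 - t`. This removes the boundary term at `1/2` in `integral_tent`. -/
theorem deriv_periodicLift_half (hW : IsAdmissiblePotential W) :
    deriv (periodicLift W) (1 / 2) = 0 := by
  have h1 := hW.hasDerivAt_periodicLift (t := 1 / 2)
    (coe_ne_zero_of_mem_Ioo ⟨by norm_num, by norm_num⟩)
  have h2 : HasDerivAt (fun t : ℝ => periodicLift W (1 - t))
      (-deriv (periodicLift W) (1 / 2)) (1 / 2) := by
    have h3 : HasDerivAt (periodicLift W) (deriv (periodicLift W) (1 / 2)) (1 - 1 / 2) := by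
      convert! h1 using 1; norm_num
    simpa using h3.comp_const_sub (1 : ℝ) (1 / 2)
  have h4 : (fun t : ℝ => periodicLift W (1 - t)) = periodicLift W :=
    funext hW.periodicLift_one_sub
  rw [h4] at h2
  have := h1.unique h2
  linarith

/-- Subtracting `C / 2 * t ^ 2` leaves a convex function, and the quadratic has an exact convexity
defect. -/
theorem exists_strong_convex (hW : IsAdmissiblePotential W) : ∃ C : ℝ, 0 < C ∧
    ∀ a ∈ Ioo (0 : ℝ) 1, ∀ b ∈ Ioo (0 : ℝ) 1, ∀ s t : ℝ, 0 < s → 0 < t → s + t = 1 →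
      periodicLift W (s * a + t * b) + C * s * t * (b - a) ^ 2 ≤
        s * periodicLift W a + t * periodicLift W b := by
  obtain ⟨C, hC, hconv⟩ := hW.convex
  refine ⟨C / 2, by positivity, ?_⟩
  have hcv : ConvexOn ℝ (Ioo (0 : ℝ) 1) fun t => periodicLift W t - C / 2 * t ^ 2 := by
    refine convexOn_of_hasDerivWithinAt2_nonneg (convex_Ioo 0 1)
      (f' := fun t => deriv (periodicLift W) t - C * t)
      (f'' := fun t => deriv (deriv (periodicLift W)) t - C) ?_ ?_ ?_ ?_
    · intro t ht
      refine ContinuousAt.continuousWithinAt ?_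
      exact (hW.hasDerivAt_periodicLift (coe_ne_zero_of_mem_Ioo ht)).continuousAt.sub
        (by fun_prop)
    · intro t ht
      rw [interior_Ioo] at ht
      refine HasDerivAt.hasDerivWithinAt ?_
      convert! (hW.hasDerivAt_periodicLift (coe_ne_zero_of_mem_Ioo ht)).sub
        ((hasDerivAt_pow 2 t).const_mul (C / 2)) using 1
      simp; ring
    · intro t ht
      rw [interior_Ioo] at ht
      refine HasDerivAt.hasDerivWithinAt ?_
      convert! (hW.hasDerivAt_deriv_periodicLift (coe_ne_zero_of_mem_Ioo ht)).sub
        ((hasDerivAt_id t).const_mul C) using 1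
      simp
    · intro t ht
      rw [interior_Ioo] at ht
      exact sub_nonneg.2 (hconv t (coe_ne_zero_of_mem_Ioo ht))
  intro a ha b hb s t hs ht hst
  have := hcv.2 ha hb hs.le ht.le hst
  simp only [smul_eq_mul] at this
  have e : s * a ^ 2 + t * b ^ 2 - (s * a + t * b) ^ 2 = s * t * (b - a) ^ 2 := by
    obtain rfl : t = 1 - s := by linarith
    ring
  nlinarith

/-- By evenness `W` agrees at `t` and `1 - t`, whose midpoint is `1/2`. -/
theorem potentialMin_le (hW : IsAdmissiblePotential W) {t : ℝ} (ht : (t : Torus) ≠ 0) :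
    potentialMin W ≤ periodicLift W t := by
  obtain ⟨C, hC, hconv⟩ := hW.exists_strong_convex
  have h01 : Int.fract t ∈ Ioo (0 : ℝ) 1 := by
    refine ⟨lt_of_le_of_ne (Int.fract_nonneg t) fun h => ht ?_, Int.fract_lt_one t⟩
    have : t = ⌊t⌋ := by linarith [Int.self_sub_floor t]
    rw [this, torus_coe_int]
  have h := hconv _ h01 (1 - Int.fract t) ⟨by linarith [h01.2], by linarith [h01.1]⟩ (1 / 2) (1 / 2)
    (by norm_num) (by norm_num) (by norm_num)
  rw [hW.periodicLift_one_sub, ← Int.self_sub_floor, periodicLift_sub_int] at h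
  rw [show 1 / 2 * (t - (⌊t⌋ : ℝ)) + 1 / 2 * (1 - (t - (⌊t⌋ : ℝ))) = 1 / 2 by ring] at h
  have h2 : potentialMin W = periodicLift W (1 / 2) := rfl
  have h3 : 0 ≤ C * (1 / 2) * (1 / 2) * (1 - (t - (⌊t⌋ : ℝ)) - (t - (⌊t⌋ : ℝ))) ^ 2 := by positivity
  linarith

theorem shiftedKernel_coe (hW : IsAdmissiblePotential W) {t : ℝ} (ht : (t : Torus) ≠ 0) :
    shiftedKernel W (t : Torus) = ENNReal.ofReal (periodicLift W t - potentialMin W) := by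
  rw [shiftedKernel, hW.coe_periodicLift ht, ← EReal.coe_sub, EReal.real_coe_toENNReal]

theorem shiftedKernel_zero (hW : IsAdmissiblePotential W) : shiftedKernel W 0 = ⊤ := by
  rw [shiftedKernel, hW.at_zero, EReal.top_sub_coe, EReal.toENNReal_top]

theorem eq_add_shiftedKernel (hW : IsAdmissiblePotential W) (x : Torus) :
    W x = (potentialMin W : EReal) + (shiftedKernel W x : EReal) := by
  by_cases hx : x = 0
  · rw [hx, hW.shiftedKernel_zero, hW.at_zero, EReal.coe_ennreal_top, EReal.coe_add_top]
  · obtain ⟨t, rfl⟩ := QuotientAddGroup.mk_surjective x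
    have h := hW.potentialMin_le hx
    change W (t : Torus) = (potentialMin W : EReal) + (shiftedKernel W (t : Torus) : EReal)
    rw [hW.shiftedKernel_coe hx, EReal.coe_ennreal_ofReal, max_eq_left (sub_nonneg.2 h),
      ← EReal.coe_add, add_sub_cancel, hW.coe_periodicLift hx]

theorem shiftedKernel_neg (hW : IsAdmissiblePotential W) (x : Torus) :
    shiftedKernel W (-x) = shiftedKernel W x := by
  rw [shiftedKernel, hW.even, shiftedKernel]

theorem continuous_shiftedKernel (hW : IsAdmissiblePotential W) :
    Continuous (shiftedKernel W) := by
  rw [continuous_iff_continuousAt]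
  intro x
  by_cases hx : x = 0
  · subst hx
    have hWc : ContinuousAt W 0 := by
      rw [continuousAt_iff_punctured_nhds, hW.at_zero]
      exact hW.tendsto_zero
    have hadd : ContinuousAt (fun x => W x - (potentialMin W : EReal)) 0 := by
      simp only [sub_eq_add_neg, ← EReal.coe_neg]
      refine ContinuousAt.comp (g := fun p : EReal × EReal => p.1 + p.2)
        (f := fun x => (W x, ((-potentialMin W : ℝ) : EReal))) ?_ (hWc.prodMk continuousAt_const)
      exact EReal.continuousAt_add (Or.inr (EReal.coe_ne_bot _)) (Or.inr (EReal.coe_ne_top _))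
    exact EReal.continuous_toENNReal.continuousAt.comp hadd
  · obtain ⟨t, rfl⟩ := QuotientAddGroup.mk_surjective x
    refine (QuotientAddGroup.isOpenQuotientMap_mk).continuousAt_comp_iff.1 ?_
    have h1 : ContinuousAt (fun t => ENNReal.ofReal (periodicLift W t - potentialMin W)) t :=
      ENNReal.continuous_ofReal.continuousAt.comp
        ((hW.hasDerivAt_periodicLift hx).continuousAt.sub continuousAt_const)
    refine h1.congr ?_
    filter_upwards [isOpen_coe_ne_zero.mem_nhds hx] with s hs
    exact (hW.shiftedKernel_coe hs).symm

theorem ae_ne_zero : ∀ᵐ x : Torus, x ≠ 0 := by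
  have := volume_torus_closedBall 0 (show (0 : ℝ) ≤ 1 / 2 by norm_num)
  rw [Metric.closedBall_zero, mul_zero, ENNReal.ofReal_zero] at this
  simpa [ae_iff] using this

/-- Mean zero makes the shift equal to the integral. The sign of the minimum is used again when
integrals are split into positive and negative parts. -/
theorem lintegral_shiftedKernel (hW : IsAdmissiblePotential W) :
    ∫⁻ x, shiftedKernel W x = ENNReal.ofReal (-potentialMin W) ∧ potentialMin W ≤ 0 := by
  have h1 : ∀ᵐ x : Torus, shiftedKernel W x = ENNReal.ofReal ((W x).toReal - potentialMin W) ∧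
      0 ≤ (W x).toReal - potentialMin W := by
    filter_upwards [ae_ne_zero] with x hx
    obtain ⟨t, rfl⟩ := QuotientAddGroup.mk_surjective x
    exact ⟨hW.shiftedKernel_coe hx, sub_nonneg.2 (hW.potentialMin_le hx)⟩
  have h2 : ∫ x : Torus, ((W x).toReal - potentialMin W) = -potentialMin W := by
    rw [integral_sub hW.integrable (integrable_const _), hW.mean_zero, integral_const,
      measureReal_def, UnitAddCircle.measure_univ]
    simp
  constructor
  · rw [lintegral_congr_ae (h1.mono fun x hx => hx.1), ← h2]
    exact (ofReal_integral_eq_lintegral_ofReal (hW.integrable.sub (integrable_const _))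
      (h1.mono fun x hx => hx.2)).symm
  · have := integral_nonneg_of_ae (h1.mono fun x hx => hx.2)
    rw [h2] at this
    linarith

/-- A pole at an endpoint makes the right side infinite. Otherwise translation by `⌊a⌋` brings the
whole segment into `(0, 1)`. -/
theorem shiftedKernel_convex (hW : IsAdmissiblePotential W) :
    ∃ C : ℝ, 0 < C ∧ ∀ a b s t : ℝ, a < b → (∀ n : ℤ, (n : ℝ) ∉ Ioo a b) →
      0 < s → 0 < t → s + t = 1 →
      shiftedKernel W ((s * a + t * b : ℝ) : Torus) + ENNReal.ofReal (C * s * t * (b - a) ^ 2) ≤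
        ENNReal.ofReal s * shiftedKernel W (a : Torus) +
          ENNReal.ofReal t * shiftedKernel W (b : Torus) := by
  obtain ⟨C, hC, hconv⟩ := hW.exists_strong_convex
  refine ⟨C, hC, fun a b s t hab hn hs ht hst => ?_⟩
  by_cases ha : (a : Torus) = 0
  · rw [ha, hW.shiftedKernel_zero, ENNReal.mul_top (by simpa using hs), top_add]; exact le_top
  by_cases hb : (b : Torus) = 0
  · rw [hb, hW.shiftedKernel_zero, ENNReal.mul_top (by simpa using ht), add_top]; exact le_top
  have ha1 : ((⌊a⌋ : ℤ) : ℝ) < a := lt_of_le_of_ne (Int.floor_le a) fun h => ha (by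
    rw [← h, torus_coe_int])
  have hb1 : b < ⌊a⌋ + 1 := by
    by_contra hcon
    rw [not_lt] at hcon
    rcases hcon.lt_or_eq with h | h
    · exact hn (⌊a⌋ + 1) ⟨by push_cast; exact Int.lt_floor_add_one a, by push_cast; exact h⟩
    · refine hb ?_
      rw [← h, torus_coe_add_one, torus_coe_int]
  have ha' : a - ⌊a⌋ ∈ Ioo (0 : ℝ) 1 := ⟨by linarith, by linarith⟩
  have hb' : b - ⌊a⌋ ∈ Ioo (0 : ℝ) 1 := ⟨by linarith, by linarith⟩
  have hmem : s * (a - ⌊a⌋) + t * (b - ⌊a⌋) ∈ Ioo (0 : ℝ) 1 :=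
    convex_Ioo 0 1 ha' hb' hs.le ht.le hst
  have hm : s * (a - ⌊a⌋) + t * (b - ⌊a⌋) = s * a + t * b - ⌊a⌋ := by
    linear_combination (-(⌊a⌋ : ℝ)) * hst
  have hne : ((s * a + t * b : ℝ) : Torus) ≠ 0 := by
    have := coe_ne_zero_of_mem_Ioo hmem
    rwa [hm, AddCircle.coe_sub, torus_coe_int, sub_zero] at this
  have key := hconv _ ha' _ hb' s t hs ht hst
  rw [hm, periodicLift_sub_int, periodicLift_sub_int, periodicLift_sub_int,
    sub_sub_sub_cancel_right] at key
  have h1 := sub_nonneg.2 (hW.potentialMin_le ha)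
  have h2 := sub_nonneg.2 (hW.potentialMin_le hb)
  have h3 := sub_nonneg.2 (hW.potentialMin_le hne)
  rw [hW.shiftedKernel_coe ha, hW.shiftedKernel_coe hb, hW.shiftedKernel_coe hne,
    ← ENNReal.ofReal_mul hs.le, ← ENNReal.ofReal_mul ht.le, ← ENNReal.ofReal_add h3 (by positivity),
    ← ENNReal.ofReal_add (by positivity) (by positivity)]
  refine ENNReal.ofReal_le_ofReal ?_
  have : s * potentialMin W + t * potentialMin W = potentialMin W := by rw [← add_mul, hst, one_mul]
  linarith

/-- Taylor's formula at `1/2` with integral remainder; the first-order term vanishes there. -/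
theorem integral_tent (hW : IsAdmissiblePotential W) {x : ℝ} (hx : 0 < x) (hx' : x ≤ 1 / 2) :
    ∫ s in x..1 / 2, (s - x) * deriv (deriv (periodicLift W)) s =
      periodicLift W x - potentialMin W := by
  have hne : ∀ s ∈ uIcc x (1 / 2), (s : Torus) ≠ 0 := by
    intro s hs
    rw [uIcc_of_le hx'] at hs
    exact coe_ne_zero_of_mem_Ioo ⟨hx.trans_le hs.1, by linarith [hs.2]⟩
  have hderiv : ∀ s ∈ uIcc x (1 / 2), HasDerivAt
      (fun s => (s - x) * deriv (periodicLift W) s - periodicLift W s)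
      ((s - x) * deriv (deriv (periodicLift W)) s) s := by
    intro s hs
    have := (((hasDerivAt_id s).sub_const x).mul (hW.hasDerivAt_deriv_periodicLift (hne s hs))).sub
      (hW.hasDerivAt_periodicLift (hne s hs))
    convert! this using 1
    simp
  rw [intervalIntegral.integral_eq_sub_of_hasDerivAt hderiv]
  · rw [hW.deriv_periodicLift_half, potentialMin, periodicLift, periodicLift]
    ring
  · refine ContinuousOn.intervalIntegrable ?_
    exact (continuousOn_id.sub continuousOn_const).mul
      (hW.continuousOn_deriv_deriv.mono fun s hs => hne s hs)

theorem deriv_deriv_pos (hW : IsAdmissiblePotential W) {t : ℝ} (ht : (t : Torus) ≠ 0) :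
    0 < deriv (deriv (periodicLift W)) t := by
  obtain ⟨C, hC, hconv⟩ := hW.convex
  exact hC.trans_le (hconv t ht)

theorem lintegral_tent (hW : IsAdmissiblePotential W) {x : ℝ} (hx : 0 < x) (hx' : x ≤ 1 / 2) :
    ∫⁻ s in Ioo (0 : ℝ) (1 / 2), ENNReal.ofReal (deriv (deriv (periodicLift W)) s) *
      ENNReal.ofReal (s - x) = ENNReal.ofReal (periodicLift W x - potentialMin W) := by
  have hne : ∀ s ∈ Icc x (1 / 2), (s : Torus) ≠ 0 := fun s hs =>
    coe_ne_zero_of_mem_Ioo ⟨hx.trans_le hs.1, by linarith [hs.2]⟩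
  have h1 : ∫⁻ s in Ioo (0 : ℝ) (1 / 2), ENNReal.ofReal (deriv (deriv (periodicLift W)) s) *
      ENNReal.ofReal (s - x) = ∫⁻ s in Ioo x (1 / 2),
        ENNReal.ofReal ((s - x) * deriv (deriv (periodicLift W)) s) := by
    rw [← lintegral_indicator measurableSet_Ioo, ← lintegral_indicator measurableSet_Ioo]
    refine lintegral_congr fun s => ?_
    by_cases hs : s ∈ Ioo x (1 / 2)
    · have hs' : s ∈ Ioo (0 : ℝ) (1 / 2) := ⟨hx.trans hs.1, hs.2⟩
      rw [indicator_of_mem hs, indicator_of_mem hs', mul_comm,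
        ENNReal.ofReal_mul (sub_nonneg.2 hs.1.le)]
    · rw [indicator_of_notMem hs]
      by_cases hs' : s ∈ Ioo (0 : ℝ) (1 / 2)
      · rw [indicator_of_mem hs']
        have : s ≤ x := not_lt.1 fun h => hs ⟨h, hs'.2⟩
        rw [ENNReal.ofReal_of_nonpos (sub_nonpos.2 this), mul_zero]
      · rw [indicator_of_notMem hs']
  have hint : IntegrableOn (fun s => (s - x) * deriv (deriv (periodicLift W)) s)
      (Ioc x (1 / 2)) := by
    refine (ContinuousOn.integrableOn_Icc ?_).mono_set Ioc_subset_Icc_self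
    exact (continuousOn_id.sub continuousOn_const).mul
      (hW.continuousOn_deriv_deriv.mono fun s hs => hne s hs)
  rw [h1, restrict_Ioo_eq_restrict_Ioc, ← hW.integral_tent hx hx',
    intervalIntegral.integral_of_le hx', ofReal_integral_eq_lintegral_ofReal hint]
  filter_upwards [ae_restrict_mem measurableSet_Ioc] with s hs
  exact mul_nonneg (sub_nonneg.2 hs.1.le) (hW.deriv_deriv_pos (hne s ⟨hs.1.le, hs.2⟩)).le

theorem shiftedKernel_eq_tents (hW : IsAdmissiblePotential W) (x : Torus) :
    shiftedKernel W x = ∫⁻ s in Ioo (0 : ℝ) (1 / 2),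
      ENNReal.ofReal (deriv (deriv (periodicLift W)) s) * ENNReal.ofReal (s - ‖x‖) := by
  by_cases hx : x = 0
  · subst hx
    rw [hW.shiftedKernel_zero, norm_zero]
    have h1 : Tendsto (fun t : ℝ => shiftedKernel W (t : Torus)) (𝓝[>] 0) (𝓝 ⊤) := by
      have : Tendsto (fun t : ℝ => shiftedKernel W (t : Torus)) (𝓝 0)
          (𝓝 (shiftedKernel W ((0 : ℝ) : Torus))) :=
        (hW.continuous_shiftedKernel.comp (AddCircle.continuous_mk' 1)).tendsto (0 : ℝ)
      rw [show ((0 : ℝ) : Torus) = 0 from rfl, hW.shiftedKernel_zero] at this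
      exact this.mono_left nhdsWithin_le_nhds
    -- At the pole both sides are infinite: the tent integral there dominates the one at each small
    -- `t > 0`, which tends to `⊤`.
    refine (top_le_iff.1 (le_of_tendsto h1 ?_)).symm
    filter_upwards [Ioo_mem_nhdsGT (show (0 : ℝ) < 1 / 2 by norm_num)] with t ht
    rw [hW.shiftedKernel_coe (coe_ne_zero_of_mem_Ioo ⟨ht.1, by linarith [ht.2]⟩),
      ← hW.lintegral_tent ht.1 ht.2.le]
    refine lintegral_mono fun s => mul_le_mul_right (ENNReal.ofReal_le_ofReal ?_) _
    linarith [ht.1]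
  · obtain ⟨t, rfl, ht1, ht2⟩ := exists_coe_eq_abs_le x
    have htabs : |t| ≤ 1 / 2 := abs_le.2 ⟨ht1.le, ht2⟩
    have ht0 : 0 < |t| := abs_pos.2 (by rintro rfl; exact hx rfl)
    rw [torus_norm_coe_eq_abs htabs, hW.lintegral_tent ht0 htabs,
      ← hW.shiftedKernel_coe (coe_ne_zero_of_mem_Ioo ⟨ht0, by linarith⟩)]
    rcases abs_choice t with h | h
    · rw [h]
    · rw [h, AddCircle.coe_neg, hW.shiftedKernel_neg]

theorem isConvexKernel (hW : IsAdmissiblePotential W) : IsConvexKernel (shiftedKernel W) where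
  zero := hW.shiftedKernel_zero
  ne_top x hx := by
    obtain ⟨t, rfl⟩ := QuotientAddGroup.mk_surjective x
    exact (hW.shiftedKernel_coe hx).trans_ne ENNReal.ofReal_ne_top
  even := hW.shiftedKernel_neg
  continuous := hW.continuous_shiftedKernel
  lintegral_ne_top := hW.lintegral_shiftedKernel.1.trans_ne ENNReal.ofReal_ne_top
  convex := hW.shiftedKernel_convex
  tents := ⟨fun s => ENNReal.ofReal (deriv (deriv (periodicLift W)) s),
    ENNReal.measurable_ofReal.comp (measurable_deriv _),
    fun s hs => (ENNReal.ofReal_pos.2 (hW.deriv_deriv_pos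
      (coe_ne_zero_of_mem_Ioo ⟨hs.1, by linarith [hs.2]⟩))).ne',
    fun _ => ENNReal.ofReal_ne_top, hW.shiftedKernel_eq_tents⟩

end IsAdmissiblePotential

/-! ### Transfer between extended real potentials and the nonnegative kernel. -/

/-- With `f = c + g` this is `f = f⁺ - f⁻` rearranged into sums, so that `g = ⊤` is allowed and both
sides can be integrated. -/
theorem toENNReal_add_neg_toENNReal (c : ℝ) (hc : c ≤ 0) (g : ENNReal) :
    ((c : EReal) + (g : EReal)).toENNReal + ENNReal.ofReal (-c) =
      g + (-((c : EReal) + (g : EReal))).toENNReal := by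
  by_cases hg : g = ⊤
  · subst hg
    simp
  · lift g to NNReal using hg
    have : ((g : ENNReal) : EReal) = ((g : ℝ) : EReal) := rfl
    rw [this, ← EReal.coe_add, ← EReal.coe_neg, EReal.real_coe_toENNReal, EReal.real_coe_toENNReal,
      ← ENNReal.ofReal_coe_nnreal]
    rcases le_total 0 (c + g) with h | h
    · rw [ENNReal.ofReal_of_nonpos (neg_nonpos.2 h), add_zero,
        ← ENNReal.ofReal_add h (neg_nonneg.2 hc)]
      congr 1; ring
    · rw [ENNReal.ofReal_of_nonpos h, zero_add, ← ENNReal.ofReal_add g.coe_nonneg (neg_nonneg.2 h)]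
      congr 1; ring

/-- The negative part is bounded by `-c`, so its integral is finite and may be subtracted. -/
theorem extIntegral_const_add (ρ : Measure Torus) [IsProbabilityMeasure ρ] {c : ℝ} (hc : c ≤ 0)
    {g : Torus → ENNReal} (hg : Measurable g) :
    extIntegral ρ (fun y => (c : EReal) + (g y : EReal)) =
      (c : EReal) + ((∫⁻ y, g y ∂ρ : ENNReal) : EReal) := by
  have hm : Measurable fun y => ((c : EReal) + (g y : EReal)).toENNReal :=
    (measurable_const.add (measurable_coe_ennreal_ereal.comp hg)).ereal_toENNReal
  have hN : ∫⁻ y, (-((c : EReal) + (g y : EReal))).toENNReal ∂ρ ≤ ENNReal.ofReal (-c) := by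
    calc _ ≤ ∫⁻ _, ENNReal.ofReal (-c) ∂ρ := by
          refine lintegral_mono fun y => ?_
          rw [← EReal.real_coe_toENNReal]
          refine EReal.toENNReal_le_toENNReal ?_
          rw [EReal.coe_neg, EReal.neg_le_neg_iff]
          exact le_add_of_nonneg_right (EReal.coe_ennreal_nonneg _)
      _ = _ := by simp
  have hsum : ∫⁻ y, ((c : EReal) + (g y : EReal)).toENNReal ∂ρ + ENNReal.ofReal (-c) =
      ∫⁻ y, g y ∂ρ + ∫⁻ y, (-((c : EReal) + (g y : EReal))).toENNReal ∂ρ := by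
    rw [← lintegral_add_left hg, ← lintegral_congr fun y => toENNReal_add_neg_toENNReal c hc (g y),
      lintegral_add_left hm]
    simp
  rw [extIntegral]
  generalize ∫⁻ y, ((c : EReal) + (g y : EReal)).toENNReal ∂ρ = P at hsum ⊢
  generalize ∫⁻ y, (-((c : EReal) + (g y : EReal))).toENNReal ∂ρ = N at hsum hN ⊢
  generalize ∫⁻ y, g y ∂ρ = G at hsum ⊢
  have hNt : N ≠ ⊤ := ne_top_of_le_ne_top ENNReal.ofReal_ne_top hN
  lift N to NNReal using hNt
  have hNc : ((N : ENNReal) : EReal) = ((N : ℝ) : EReal) := rfl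
  by_cases hG : G = ⊤
  · have hP : P = ⊤ := by
      rw [hG, top_add] at hsum
      exact (ENNReal.add_eq_top.1 hsum).resolve_right ENNReal.ofReal_ne_top
    rw [hP, hG, hNc, EReal.coe_ennreal_top, EReal.top_sub_coe, EReal.coe_add_top]
  · have hP : P ≠ ⊤ := fun h => by
      rw [h, top_add] at hsum
      exact ENNReal.add_ne_top.2 ⟨hG, ENNReal.coe_ne_top⟩ hsum.symm
    lift P to NNReal using hP
    lift G to NNReal using hG
    have h1 := congrArg ENNReal.toReal hsum
    rw [ENNReal.toReal_add ENNReal.coe_ne_top ENNReal.ofReal_ne_top,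
      ENNReal.toReal_add ENNReal.coe_ne_top ENNReal.coe_ne_top,
      ENNReal.toReal_ofReal (neg_nonneg.2 hc)] at h1
    simp only [ENNReal.coe_toReal] at h1
    change ((P : ℝ) : EReal) - ((N : ℝ) : EReal) = (c : EReal) + ((G : ℝ) : EReal)
    rw [← EReal.coe_sub, ← EReal.coe_add]
    congr 1
    linarith

theorem essInf_const_add (c : ℝ) (g : Torus → ENNReal) :
    essInf (fun x => (c : EReal) + (g x : EReal)) volume =
      (c : EReal) + ((essInf g volume : ENNReal) : EReal) := by
  apply le_antisymm
  · set e := essInf (fun x => (c : EReal) + (g x : EReal)) volume with he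
    have h1 : ∀ᵐ x : Torus, e ≤ (c : EReal) + (g x : EReal) := ae_essInf_le
    have h2 : (e - (c : EReal)).toENNReal ≤ essInf g volume := by
      refine le_essInf_of_ae_le _ ?_
      filter_upwards [h1] with x hx
      rw [← EReal.toENNReal_coe (x := g x)]
      refine EReal.toENNReal_le_toENNReal ?_
      refine EReal.sub_le_of_le_add ?_
      rwa [add_comm]
    have h3 : e - (c : EReal) ≤ ((essInf g volume : ENNReal) : EReal) :=
      (EReal.coe_toENNReal_eq_max ▸ le_max_right _ _ :
        e - (c : EReal) ≤ ((e - (c : EReal)).toENNReal : EReal)).trans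
        (EReal.coe_ennreal_le_coe_ennreal_iff.2 h2)
    have := EReal.sub_le_iff_le_add (Or.inl (EReal.coe_ne_bot c)) (Or.inl (EReal.coe_ne_top c)) |>.1 h3
    rwa [add_comm] at this
  · refine le_essInf_of_ae_le _ ?_
    filter_upwards [(ae_essInf_le : ∀ᵐ x, essInf g volume ≤ g x)] with x hx
    exact add_le_add_right (EReal.coe_ennreal_le_coe_ennreal_iff.2 hx) _

namespace IsAdmissiblePotential

variable {W : Torus → EReal}

theorem potentialField_eq (hW : IsAdmissiblePotential W) (ρ : Measure Torus)
    [IsProbabilityMeasure ρ] :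
    potentialField W ρ = fun x =>
      (potentialMin W : EReal) + (kernelPotential (shiftedKernel W) ρ x : EReal) := by
  funext x
  rw [potentialField, kernelPotential, ← extIntegral_const_add (g := fun y => shiftedKernel W (x - y)) ρ
    hW.lintegral_shiftedKernel.2
    (hW.continuous_shiftedKernel.comp (by fun_prop : Continuous fun y => x - y)).measurable]
  congr 1
  funext y
  exact hW.eq_add_shiftedKernel _

theorem potentialField_le_essInf_iff (hW : IsAdmissiblePotential W) (ρ : Measure Torus)
    [IsProbabilityMeasure ρ] (x : Torus) :
    potentialField W ρ x ≤ essInf (potentialField W ρ) volume ↔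
      kernelPotential (shiftedKernel W) ρ x ≤
        essInf (kernelPotential (shiftedKernel W) ρ) volume := by
  rw [hW.potentialField_eq, essInf_const_add]
  rw [(EReal.addLECancellable_coe _).add_le_add_iff_left, EReal.coe_ennreal_le_coe_ennreal_iff]

theorem height_eq (hW : IsAdmissiblePotential W) (ρ : Measure Torus) [IsProbabilityMeasure ρ] :
    height W ρ = (kernelHeight (shiftedKernel W) ρ : EReal) := by
  have hut := essInf_kernelPotential_ne_top hW.isConvexKernel ρ
  rw [height, hW.potentialField_eq, essInf_const_add, kernelHeight, hW.lintegral_shiftedKernel.1,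
    ENNReal.toReal_ofReal (neg_nonneg.2 hW.lintegral_shiftedKernel.2),
    ← EReal.coe_ennreal_toReal hut, ← EReal.coe_add, ← EReal.coe_neg]
  congr 1
  ring

theorem ratioFunctional_eq (hW : IsAdmissiblePotential W) (α : ℝ) (ρ : Measure Torus)
    [IsProbabilityMeasure ρ] :
    ratioFunctional W α ρ =
      ((kernelHeight (shiftedKernel W) ρ / discrepancy ρ ^ α : ℝ) : EReal) := by
  rw [ratioFunctional, hW.height_eq, EReal.coe_div]

theorem iInf_eq (hW : IsAdmissiblePotential W) : ⨅ z, W z = (potentialMin W : EReal) := by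
  apply le_antisymm
  · refine (iInf_le _ ((1 / 2 : ℝ) : Torus)).trans_eq ?_
    exact hW.coe_periodicLift (coe_ne_zero_of_mem_Ioo ⟨by norm_num, by norm_num⟩)
  · refine le_iInf fun z => ?_
    rw [hW.eq_add_shiftedKernel z]
    exact le_add_of_nonneg_right (EReal.coe_ennreal_nonneg _)

theorem ae_coe_ne_zero : ∀ᵐ t : ℝ, (t : Torus) ≠ 0 := by
  have hc : {t : ℝ | (t : Torus) = 0}.Countable := by
    refine (countable_range fun n : ℤ => (n : ℝ)).mono fun t ht => ?_
    obtain ⟨n, hn⟩ := AddCircle.coe_eq_zero_iff 1 |>.1 ht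
    exact ⟨n, by simpa using hn⟩
  simpa [ae_iff] using hc.measure_zero volume

theorem setLIntegral_closedBall_le (w : Torus → ENNReal) (t r : ℝ) :
    ∫⁻ y in Metric.closedBall (t : Torus) r, w y ≤ ∫⁻ y in Ioc (t - r) (t + r), w (y : Torus) := by
  rw [← lintegral_indicator measurableSet_closedBall,
    ← AddCircle.lintegral_preimage 1 (t - 1 / 2), Measure.restrict_congr_set (Ioc_ae_eq_Icc (a := t - r)),
    ← lintegral_indicator measurableSet_Ioc, ← lintegral_indicator measurableSet_Icc]
  refine lintegral_mono fun y => ?_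
  by_cases hy : y ∈ Ioc (t - 1 / 2) (t - 1 / 2 + 1)
  · rw [indicator_of_mem hy]
    by_cases hyb : (y : Torus) ∈ Metric.closedBall (t : Torus) r
    · rw [indicator_of_mem hyb]
      rw [Metric.mem_closedBall, dist_eq_norm, ← AddCircle.coe_sub,
        torus_norm_coe_eq_abs (abs_le.2 ⟨by linarith [hy.1], by linarith [hy.2]⟩), abs_le] at hyb
      rw [indicator_of_mem (show y ∈ Icc (t - r) (t + r) from ⟨by linarith, by linarith⟩)]
    · rw [indicator_of_notMem hyb]; exact bot_le
  · rw [indicator_of_notMem hy]; exact bot_le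

theorem integrableOn_periodicLift (hW : IsAdmissiblePotential W) (t : ℝ) {r : ℝ}
    (hr' : r < 1 / 2) :
    IntegrableOn (periodicLift W) (Ioc (t - r) (t + r)) := by
  have h := (AddCircle.measurePreserving_mk 1 (t - 1 / 2)).integrable_comp_of_integrable
    hW.integrable
  refine IntegrableOn.mono_set (t := Ioc (t - 1 / 2) (t - 1 / 2 + 1)) h ?_
  exact Ioc_subset_Ioc (by linarith) (by linarith)

/-- The average bound for the shifted kernel. -/
theorem laverage_shiftedKernel_le (hW : IsAdmissiblePotential W) (hA : AverageBound W) :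
    ∃ K c : ENNReal, K ≠ ⊤ ∧ c ≠ ⊤ ∧ ∀ r : ℝ, 0 < r → r < 1 / 2 → ∀ x,
      (ENNReal.ofReal (2 * r))⁻¹ * ∫⁻ y in Metric.closedBall x r, shiftedKernel W y ≤
        K * shiftedKernel W x + c := by
  obtain ⟨C, hC, hb⟩ := hA
  have hc0 := hW.lintegral_shiftedKernel.2
  -- With `p` the minimum, `C (W - 2p) = C (W - p) + C (-p)`; on the left, `-2p` may be replaced by
  -- `-p` because `p ≤ 0`.
  refine ⟨ENNReal.ofReal C, ENNReal.ofReal (C * -potentialMin W), ENNReal.ofReal_ne_top,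
    ENNReal.ofReal_ne_top, fun r hr hr' x => ?_⟩
  by_cases hx : x = 0
  · rw [hx, hW.shiftedKernel_zero, ENNReal.mul_top (by simpa using hC), top_add]
    exact le_top
  obtain ⟨t, rfl⟩ := QuotientAddGroup.mk_surjective x
  have hx' : (t : Torus) ≠ 0 := hx
  have h1 := hb r hr hr' t
  rw [hW.iInf_eq, hW.coe_periodicLift hx'] at h1
  have h2 : 1 / (2 * r) * (∫ y in (t - r)..(t + r), periodicLift W y) - 2 * potentialMin W ≤
      C * (periodicLift W t - 2 * potentialMin W) := by
    rw [show (2 : EReal) = ((2 : ℝ) : EReal) from rfl, ← EReal.coe_mul, ← EReal.coe_sub,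
      ← EReal.coe_sub, ← EReal.coe_mul, EReal.coe_le_coe_iff] at h1
    exact h1
  have hint := hW.integrableOn_periodicLift t hr'
  have h3 : ∫⁻ y in Ioc (t - r) (t + r), shiftedKernel W (y : Torus) =
      ENNReal.ofReal ((∫ y in (t - r)..(t + r), periodicLift W y) - 2 * r * potentialMin W) := by
    have e1 : ∫⁻ y in Ioc (t - r) (t + r), shiftedKernel W (y : Torus) =
        ∫⁻ y in Ioc (t - r) (t + r), ENNReal.ofReal (periodicLift W y - potentialMin W) := by
      refine lintegral_congr_ae (ae_restrict_of_ae ?_)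
      filter_upwards [ae_coe_ne_zero] with y hy using hW.shiftedKernel_coe hy
    have e2 : ∫ y in Ioc (t - r) (t + r), (periodicLift W y - potentialMin W) =
        (∫ y in (t - r)..(t + r), periodicLift W y) - 2 * r * potentialMin W := by
      rw [integral_sub hint (integrable_const _), intervalIntegral.integral_of_le (by linarith),
        setIntegral_const, Real.volume_real_Ioc_of_le (by linarith), smul_eq_mul]
      ring
    rw [e1, ← e2]
    refine (ofReal_integral_eq_lintegral_ofReal (hint.sub (integrable_const _))
      (ae_restrict_of_ae ?_)).symm
    filter_upwards [ae_coe_ne_zero] with y hy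
    exact sub_nonneg.2 (hW.potentialMin_le hy)
  have hr2 : 0 < 2 * r := by linarith
  have hm := sub_nonneg.2 (hW.potentialMin_le hx')
  calc (ENNReal.ofReal (2 * r))⁻¹ * ∫⁻ y in Metric.closedBall (t : Torus) r, shiftedKernel W y
      ≤ (ENNReal.ofReal (2 * r))⁻¹ * ENNReal.ofReal
        ((∫ y in (t - r)..(t + r), periodicLift W y) - 2 * r * potentialMin W) := by
        rw [← h3]
        exact mul_le_mul_right (setLIntegral_closedBall_le _ t r) _
    _ = ENNReal.ofReal (1 / (2 * r) * (∫ y in (t - r)..(t + r), periodicLift W y) -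
        potentialMin W) := by
        rw [← ENNReal.ofReal_inv_of_pos hr2, ← ENNReal.ofReal_mul (by positivity)]
        congr 1
        field_simp
    _ ≤ ENNReal.ofReal (C * (periodicLift W t - potentialMin W) + C * -potentialMin W) := by
        refine ENNReal.ofReal_le_ofReal ?_
        linarith
    _ = _ := by
        rw [ENNReal.ofReal_add (by positivity) (mul_nonneg hC.le (neg_nonneg.2 hc0)),
          ENNReal.ofReal_mul hC.le]
        congr 2
        exact (hW.shiftedKernel_coe hx').symm

theorem discrepancy_volume_le : discrepancy (volume : Measure Torus) ≤ 0 := by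
  refine discrepancy_le fun a b hab _ => ?_
  have := ENNReal.toReal_mono ENNReal.ofReal_ne_top (volume_closedArc_le a b)
  rw [ENNReal.toReal_ofReal (by linarith)] at this
  rw [excess, measureReal_def]
  linarith

/-- Spreading mass near an offending point keeps the mass of `[-M, M]`, so the discrepancy does not
fall while the height falls strictly. -/
theorem isSedimentAway_of_isEvenMinimizer (hW : IsAdmissiblePotential W) {α d : ℝ} (hα : 0 ≤ α)
    (hd : 0 < d) {ρ : Measure Torus} {M : ℝ} (h : IsEvenMinimizer W α d ρ M) :
    IsSedimentAway W M ρ := by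
  have hρ := h.isMinimizer.1.1
  have hDd := h.isMinimizer.1.2
  have hD := hd.trans_le hDd
  intro x hx h1 h2
  rw [hW.potentialField_le_essInf_iff]
  by_contra hcon
  obtain ⟨σ, hσ, hσI, hlt⟩ := exists_essInf_kernelPotential_lt hW.isConvexKernel hx
    (not_le.1 hcon) (measurableSet_closedArc (-M) M) (closedArc_mem_nhds_or h1 h2)
  have hexc : excess σ (-M) M = discrepancy ρ := by
    rw [h.witness, excess, excess, measureReal_def, measureReal_def, hσI]
  have hle : discrepancy ρ ≤ discrepancy σ := hexc ▸
    excess_le_discrepancy σ (by linarith [h.nonneg]) (by linarith [h.lt_half])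
  have hmin := h.isMinimizer.2 σ ⟨hσ, hDd.trans hle⟩
  rw [hW.ratioFunctional_eq, hW.ratioFunctional_eq, EReal.coe_le_coe_iff] at hmin
  have hHlt : kernelHeight (shiftedKernel W) σ < kernelHeight (shiftedKernel W) ρ :=
    sub_lt_sub_left ((ENNReal.toReal_lt_toReal hlt.ne_top
      (essInf_kernelPotential_ne_top hW.isConvexKernel σ)).2 hlt) _
  have hpow := Real.rpow_pos_of_pos hD α
  -- The discrepancy may have grown; since the new height is nonnegative and `α ≥ 0`, this can only
  -- lower the quotient further.
  refine not_lt.2 hmin (lt_of_le_of_lt ?_ (div_lt_div_of_pos_right hHlt hpow))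
  exact div_le_div_of_nonneg_left (kernelHeight_nonneg hW.isConvexKernel σ) hpow
    (Real.rpow_le_rpow hD.le hle hα)

end IsAdmissiblePotential

end

/-! ### The theorem. -/

theorem theorem3p1 (W : Torus → EReal) (hW : IsAdmissiblePotential W)
    (α d : ℝ) (hα : 0 ≤ α) (hd : 0 < d) (hd' : d ≤ 1) :
    (∃ (ρ : Measure Torus) (M : ℝ), IsEvenMinimizer W α d ρ M) ∧
    (∀ (ρ : Measure Torus) (M : ℝ), IsEvenMinimizer W α d ρ M →
      (∃ (m : ℝ) (ρ₁ : Measure Torus) (J K : Set Torus),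
        0 < m ∧ m ≤ 1 / 2 ∧
        ρ = ENNReal.ofReal m •
            (Measure.dirac (M : Torus) + Measure.dirac ((-M : ℝ) : Torus)) + ρ₁ ∧
        ρ₁ univ = ENNReal.ofReal (1 - 2 * m) ∧
        IsClosedInterval J ∧ IsClosedInterval K ∧
        J ⊂ (closedArc (-M) M)ᶜ ∧ K ⊂ closedArc (-M) M ∧
        ρ₁.support = J ∪ K) ∧
      IsSedimentAway W M ρ ∧
      (AverageBound W →
        ∀ μ : Measure Torus, IsProbabilityMeasure μ →
          μ {(M : Torus)} = ρ {(M : Torus)} →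
          μ {((-M : ℝ) : Torus)} = ρ {((-M : ℝ) : Torus)} →
          IsSedimentAway W M μ → μ = ρ)) := by
  have hw := hW.isConvexKernel
  refine ⟨?_, fun ρ M h => ?_⟩
  · obtain ⟨ρ, M, hρ, hρd, heven, hM, hM', hexc, hmin⟩ := exists_even_minimizer hw hα hd hd'
    refine ⟨ρ, M, ⟨⟨hρ, hρd⟩, fun μ hμ => ?_⟩, heven, hM, hM', hexc⟩
    have := hμ.1
    rw [hW.ratioFunctional_eq, hW.ratioFunctional_eq, EReal.coe_le_coe_iff]
    exact hmin μ hμ.1 hμ.2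
  have hρ := h.isMinimizer.1.1
  have hsed := hW.isSedimentAway_of_isEvenMinimizer hα hd h
  have hne : ρ ≠ volume := by
    rintro rfl
    exact (hd.trans_le h.isMinimizer.1.2).not_ge IsAdmissiblePotential.discrepancy_volume_le
  refine ⟨exists_decomposition hw ρ h.even h.nonneg h.lt_half hne fun x hx h1 h2 =>
    (hW.potentialField_le_essInf_iff ρ x).1 (hsed x hx h1 h2), hsed, ?_⟩
  intro hA μ hμ hM1 hM2 hμsed
  obtain ⟨K, c, hK, hc, havg⟩ := hW.laverage_shiftedKernel_le hA
  have hpair : ∀ (ν : Measure Torus), IsProbabilityMeasure ν → IsSedimentAway W M ν →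
      ∀ x ∈ ν.support, x ∉ ({(M : Torus), ((-M : ℝ) : Torus)} : Set Torus) →
        kernelPotential (shiftedKernel W) ν x ≤
          essInf (kernelPotential (shiftedKernel W) ν) volume := by
    intro ν _ hν x hx hxP
    simp only [mem_insert_iff, mem_singleton_iff, not_or] at hxP
    exact (hW.potentialField_le_essInf_iff ν x).1 (hν x hx hxP.1 hxP.2)
  refine measure_eq_of_sediment hw (P := {(M : Torus), ((-M : ℝ) : Torus)})
    (toFinite _).measurableSet ?_ (essInf_le_kernelPotential hw hK hc havg μ)
    (essInf_le_kernelPotential hw hK hc havg ρ) (hpair μ hμ hμsed) (hpair ρ hρ hsed)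
  -- For `M = 0` the two prescribed points coincide, and their masses must not be counted twice.
  by_cases hMM : (M : Torus) = ((-M : ℝ) : Torus)
  · rw [← hMM, pair_eq_singleton, Measure.restrict_singleton, Measure.restrict_singleton, hM1]
  · have hdisj : Disjoint {(M : Torus)} {((-M : ℝ) : Torus)} := disjoint_singleton.2 hMM
    rw [insert_eq, Measure.restrict_union hdisj (measurableSet_singleton _),
      Measure.restrict_union hdisj (measurableSet_singleton _), Measure.restrict_singleton,
      Measure.restrict_singleton, Measure.restrict_singleton, Measure.restrict_singleton, hM1, hM2]
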